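/- Let $p,m$ be fixed. For each $n$ let $y_i=x_i^T\beta+\varepsilon_i$, $i=1,\dots,n$, with $\beta\in\mathbb R^p$, deterministic covariates $x_i\in\mathbb R^p$ (the rows of $X=X_n\in\mathbb R^{n\times p}$, which may depend on $n$), and i.i.d. noise $\varepsilon_i$ with mean $0$ and variance $\sigma^2>0$. Let $\Omega\subset\mathbb R^m$, let $K(\eta)\in\mathbb R^{p\times p}$, $\eta\in\Omega$, be a family of matrices, and write $X_s,y_s$ for the rows of $X$ and the entries of $y$ with index in $s\subset\{1,\dots,n\}$, and $s^c$ for the complement of $s$. For $1\le k\le n-1$ (with $k=k_n$) put $$\widehat\beta_{s^c}=(X_{s^c}^TX_{s^c}+\sigma^2K^{-1})^{-1}X_{s^c}^Ty_{s^c},\qquad \mathscr C_n(K)=\binom nk^{-1}\sum_{|s|=k}\frac1k\|y_s-X_s\widehat\beta_{s^c}\|^2,$$ the sum being over all $s\subset\{1,\dots,n\}$ with $k$ elements; the leave-$k$-out cross-validation estimator of $\eta$ is the minimizer over $\Omega$ of $\mathscr C_n(K(\eta))$. For a positive definite $p\times p$ matrix $\Sigma$ let $$W(K)=\beta^TK^{-1}\Sigma^{-1}K^{-1}\beta-2\,\mathrm{Tr}(\Sigma^{-1}K^{-1}).$$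 Assume: 1. $X^TX/n\to\Sigma$, and $K(\eta)$ is symmetric positive definite for every interior point $\eta$ of $\Omega$. 2. The set of global minima of $W(K(\eta))$ over those $\eta\in\Omega$ for which $K(\eta)$ is positive definite is non-empty, and consists of interior points of $\Omega$ that are isolated in this set. 3. $\sup_iE|\varepsilon_i|^4<\infty$; $\sup_n\max_{i\le n}\|x_i\|<\infty$; and the partial derivatives $\partial K(\eta)/\partial\eta_i$, $i=1,\dots,m$, exist and are continuous in the interior of $\Omega$. For a function $f$ of the matrix $K$ let $\partial f/\partial K$ be the matrix of its partial derivatives with respect to the entries $K_{ij}$. Let $\widehat\psi_n$ and $\psi^*$ be the sets of interior points $\eta$ of $\Omega$ with $$\mathrm{Tr}\Big(\frac{\partial\mathscr C_n}{\partial K}(K(\eta))\,\frac{\partial K(\eta)}{\partial\eta_i}\Big)=0\ \ (i=1,\dots,m),\qquad \mathrm{Tr}\Big(\frac{\partial W}{\partial K}(K(\eta))\,\frac{\partial K(\eta)}{\partial\eta_i}\Big)=0\ \ (i=1,\dots,m),$$ respectively. The leave-$k$-out estimator is called asymptotically optimal to the first order if $\inf_{a\in\widehat\psi_n,\,b\in\psi^*}\|a-b\|\to0$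 in probability as $n\to\infty$ (the infimum being $+\infty$ if one of the sets is empty). Suppose that $\lambda=\lim_{n\to\infty}k/n$ exists. 1) If $\lambda=0$, then the leave-$k$-out estimator is asymptotically optimal to the first order, and for every interior point $\eta$ of $\Omega$, with $K=K(\eta)$, $$n^2\frac{\partial\mathscr C_n}{\partial K}\to2\sigma^4K^{-1}\Sigma^{-1}K^{-1}(K-\beta\beta^T)K^{-1}\quad\text{in probability as }n\to\infty.$$ 2) If $0<\lambda<1$ and $X_s^TX_s/k\to\Sigma$ as $n\to\infty$ along all $s\subset\{1,\dots,n\}$ with $k$ elements (that is, uniformly over such $s$), then the leave-$k$-out estimator is asymptotically optimal to the first order, and for every interior point $\eta$ of $\Omega$, with $K=K(\eta)$, $$n^2\frac{\partial\mathscr C_n}{\partial K}\to\frac{2\sigma^4}{(1-\lambda)^2}K^{-1}\Sigma^{-1}K^{-1}(K-\beta\beta^T)K^{-1}\quad\text{in probability as }n\to\infty.$$ -/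

import Mathlib

open MeasureTheory ProbabilityTheory Filter Topology Matrix

noncomputable section

namespace LKOCV

/-- The rows of `X` indexed by the set `s` (the matrix `X_s`). -/
def rows {n p : ℕ} (X : Matrix (Fin n) (Fin p) ℝ) (s : Finset (Fin n)) :
    Matrix s (Fin p) ℝ :=
  X.submatrix (fun i : s => (i : Fin n)) id

/-- The entries of `y` indexed by the set `s` (the vector `y_s`). -/
def entries {n : ℕ} (y : Fin n → ℝ) (s : Finset (Fin n)) : s → ℝ :=
  fun i => y i

/-- The regularized least squares estimator
`(Xᵀ X + σ² K⁻¹)⁻¹ Xᵀ y` with regularization matrix `σ² K⁻¹`. -/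
def rls {ι : Type*} [Fintype ι] {p : ℕ} (σ : ℝ) (X : Matrix ι (Fin p) ℝ) (y : ι → ℝ)
    (K : Matrix (Fin p) (Fin p) ℝ) : Fin p → ℝ :=
  (Xᵀ * X + σ ^ 2 • K⁻¹)⁻¹ *ᵥ (Xᵀ *ᵥ y)

/-- Average prediction error `(1/k) ‖y_s - X_s β̂_{sᶜ}‖²` over the validation block `s`, where
`k = #s` and `β̂_{sᶜ}` is the regularized least squares estimator from the training data `sᶜ`. -/
def ape {n p : ℕ} (σ : ℝ) (X : Matrix (Fin n) (Fin p) ℝ) (y : Fin n → ℝ) (s : Finset (Fin n))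
    (K : Matrix (Fin p) (Fin p) ℝ) : ℝ :=
  (s.card : ℝ)⁻¹ *
    ∑ i : s, ((entries y s - rows X s *ᵥ rls σ (rows X sᶜ) (entries y sᶜ) K) i) ^ 2

/-- The leave-`k`-out cross validation criterion, as a function of the matrix `K`:
the mean of the average prediction errors over all blocks `s` of size `k`. -/
def lkocv {n p : ℕ} (σ : ℝ) (k : ℕ) (X : Matrix (Fin n) (Fin p) ℝ) (y : Fin n → ℝ)
    (K : Matrix (Fin p) (Fin p) ℝ) : ℝ :=
  (n.choose k : ℝ)⁻¹ * ∑ s ∈ Finset.powersetCard k (Finset.univ : Finset (Fin n)), ape σ X y s K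

/-- The observations `y = X β + ε` (the first `n` terms of the noise sequence are used). -/
def obs {Ω : Type*} {n p : ℕ} (β : Fin p → ℝ) (X : Matrix (Fin n) (Fin p) ℝ)
    (ε : ℕ → Ω → ℝ) (ω : Ω) : Fin n → ℝ :=
  fun i => (X *ᵥ β) i + ε i ω

/-- The limiting risk `βᵀ K⁻¹ Σ⁻¹ K⁻¹ β - 2 Tr(Σ⁻¹ K⁻¹)`, as a function of the matrix `K`. -/
def limitRisk {p : ℕ} (β : Fin p → ℝ) (Sig K : Matrix (Fin p) (Fin p) ℝ) : ℝ :=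
  β ⬝ᵥ ((K⁻¹ * Sig⁻¹ * K⁻¹) *ᵥ β) - 2 * (Sig⁻¹ * K⁻¹).trace

/-- The matrix derivative `∂f/∂K`: its `(i, j)` entry is the partial derivative of `f` with
respect to the entry `K i j`. -/
def matrixDeriv {p : ℕ} (f : Matrix (Fin p) (Fin p) ℝ → ℝ) (K : Matrix (Fin p) (Fin p) ℝ) :
    Matrix (Fin p) (Fin p) ℝ :=
  Matrix.of fun i j => deriv (fun t : ℝ => f (K + t • Matrix.single i j 1)) 0

/-- The matrix `∂K(η)/∂η_i` of entrywise partial derivatives. -/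
def partialDeriv {p m : ℕ} (K : EuclideanSpace ℝ (Fin m) → Matrix (Fin p) (Fin p) ℝ) (i : Fin m)
    (η : EuclideanSpace ℝ (Fin m)) : Matrix (Fin p) (Fin p) ℝ :=
  Matrix.of fun a b => lineDeriv ℝ (fun η' => K η' a b) η (EuclideanSpace.single i 1)

/-- The set of roots `η` of the first order conditions `Tr(∂f/∂K · ∂K(η)/∂η_i) = 0`,
`i = 1, …, m`. Only interior points of `Θ` are admitted: there `K` is positive definite and the
derivatives make sense. -/
def rootSet {p m : ℕ} (f : Matrix (Fin p) (Fin p) ℝ → ℝ)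
    (K : EuclideanSpace ℝ (Fin m) → Matrix (Fin p) (Fin p) ℝ)
    (Θ : Set (EuclideanSpace ℝ (Fin m))) : Set (EuclideanSpace ℝ (Fin m)) :=
  {η | η ∈ interior Θ ∧ ∀ i : Fin m, (matrixDeriv f (K η) * partialDeriv K i η).trace = 0}

/-- `inf_{a ∈ A, b ∈ B} ‖a - b‖`, with value `∞` when `A` or `B` is empty. -/
def setGap {m : ℕ} (A B : Set (EuclideanSpace ℝ (Fin m))) : ENNReal :=
  ⨅ a ∈ A, ⨅ b ∈ B, edist a b

/-- Asymptotic optimality to the first order of the hyper-parameter estimator that minimizes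
`η ↦ C n ω (K η)`: the set of roots of its first order conditions converges in probability, in
the sense of `setGap`, to the set of roots of the first order conditions of `η ↦ W (K η)`. -/
def IsAOFirstOrder {Ω : Type*} [MeasurableSpace Ω] (P : Measure Ω) {p m : ℕ}
    (C : ℕ → Ω → Matrix (Fin p) (Fin p) ℝ → ℝ) (W : Matrix (Fin p) (Fin p) ℝ → ℝ)
    (K : EuclideanSpace ℝ (Fin m) → Matrix (Fin p) (Fin p) ℝ)
    (Θ : Set (EuclideanSpace ℝ (Fin m))) : Prop :=
  ∀ δ : ENNReal, 0 < δ →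
    Tendsto (fun n => P {ω | δ ≤ setGap (rootSet (C n ω) K Θ) (rootSet W K Θ)}) atTop (𝓝 0)

/-- The global minima over `Θ` of `η ↦ W (K η)`, where `K η` has to be positive definite for
`W (K η)` to be meaningful. -/
def minimizers {p m : ℕ} (W : Matrix (Fin p) (Fin p) ℝ → ℝ)
    (K : EuclideanSpace ℝ (Fin m) → Matrix (Fin p) (Fin p) ℝ)
    (Θ : Set (EuclideanSpace ℝ (Fin m))) : Set (EuclideanSpace ℝ (Fin m)) :=
  {η | η ∈ Θ ∧ (K η).PosDef ∧ ∀ η' ∈ Θ, (K η').PosDef → W (K η) ≤ W (K η')}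

/-- `X_sᵀ X_s / k → Σ` along all validation blocks `s` of size `k = k n`. -/
def BlocksConverge {p : ℕ} (X : (n : ℕ) → Matrix (Fin n) (Fin p) ℝ) (k : ℕ → ℕ)
    (Sig : Matrix (Fin p) (Fin p) ℝ) : Prop :=
  ∀ U ∈ 𝓝 Sig, ∀ᶠ n in atTop, ∀ s : Finset (Fin n), s.card = k n →
    (k n : ℝ)⁻¹ • ((rows (X n) s)ᵀ * rows (X n) s) ∈ U

end LKOCV

end

/-! Write `u` for the error of the full-data estimator, `S` and `A` for the regularized Gram
matrices of all data and of the training data `sᶜ`, and `E` for the block score, the sum over `s` of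
covariate times full-data residual. Two exact identities remove the refitting: the training
estimator is `β + u - A⁻¹E`, and `X_sᵀ` times its prediction error on `s` is `S A⁻¹ E`. With `N = n
A⁻¹` and `q = S / n`, the gradient of one block error times `n²` is therefore `-2σ² K⁻¹ [(n/k) N q N
E (β + u)ᵀ - N q N (E Eᵀ / k) N] K⁻¹`.

It remains to average over blocks, which is sampling without replacement. Since `N → Σ⁻¹ / (1 - λ)`
uniformly over blocks, and the mean of `E Eᵀ / k` tends to `(1 - λ) σ² Σ` (the factor is the finite
population correction), the quadratic term tends to `σ² Σ⁻¹ / (1 - λ)²`. In the linear term `E` is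
multiplied by the large factor `n/k`, so inserting the limit of `N q N` is not enough. It is
expanded exactly around a matrix that does not depend on the block. The leading part contains the
mean of `(n/k) E`, which is the total score, equal to `σ² K⁻¹ (β + u)` by the normal equations. The
remainders contain means of `k⁻¹ Γ E` with `Γ` the centered block Gram matrix; these vanish because
scores and products of covariates are asymptotically uncorrelated (`Regime.gram_mul_score`).
Together this is `Regime.sq_mul_lkocvGrad`.

All of this is deterministic once a few weighted means of the noise converge, which Chebyshev's
inequality provides in probability. Convergence in probability, uniformity over blocks and local
uniformity in `η` are encoded as filters, so ordinary limit calculus applies to all three.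

For optimality, pairing with the symmetric matrices `∂K/∂η_i` turns the limit into `σ⁴ / (1 - λ)²`
times the gradient of `W`. Around an isolated minimizer of `W`, integrating the gradients along
paths parallel to the axes shows that `n² 𝒞_n` and this multiple of `W` have nearly equal increments
on a small ball. Hence `𝒞_n` has a local minimum inside the ball, and this is a root
(`isAOFirstOrder_of_tendsto`). Convergence of the criterion itself is never needed. -/

namespace LKOCV

/-! ### Entrywise calculus of matrix curves -/

/-- `M'` is the entrywise derivative at `t` of the matrix-valued curve `M`. -/
def HasEntryDerivAt {ι κ : Type*} (M : ℝ → Matrix ι κ ℝ) (M' : Matrix ι κ ℝ) (t : ℝ) : Prop :=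
  ∀ a b, HasDerivAt (fun s => M s a b) (M' a b) t

section Norm

attribute [local instance] Matrix.linftyOpNormedAddCommGroup Matrix.linftyOpNormedSpace
  Matrix.linftyOpNormedRing Matrix.linftyOpNormedAlgebra

/-- The derivative of `Ring.inverse` at a unit, read off entry by entry. The norm only serves to
make the matrices a normed algebra and does not occur in the statement. -/
theorem HasEntryDerivAt.inv {p : ℕ} {M : ℝ → Matrix (Fin p) (Fin p) ℝ}
    {M' : Matrix (Fin p) (Fin p) ℝ} {t : ℝ} (h : HasEntryDerivAt M M' t) (hu : IsUnit (M t)) :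
    HasEntryDerivAt (fun s => (M s)⁻¹) (-((M t)⁻¹ * M' * (M t)⁻¹)) t := by
  have h1 : HasDerivAt M M' t := hasDerivAt_pi.2 fun a => hasDerivAt_pi.2 fun b => h a b
  obtain ⟨x, hx⟩ := hu
  have h2 := hasFDerivAt_ringInverse (𝕜 := ℝ) x
  rw [hx] at h2
  have h3 := h2.comp_hasDerivAt t h1
  have h4 : (↑x⁻¹ : Matrix (Fin p) (Fin p) ℝ) = (M t)⁻¹ := by
    rw [← hx, Matrix.coe_units_inv]
  intro a b
  have h5 := hasDerivAt_pi.1 (hasDerivAt_pi.1 h3 a) b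
  refine (h5.congr_of_eventuallyEq (Eventually.of_forall fun s => ?_)).congr_deriv ?_
  · simp only [Function.comp_apply, Matrix.nonsing_inv_eq_ringInverse]
  · simp only [h4, _root_.neg_apply, ContinuousLinearMap.mulLeftRight_apply,
      Matrix.neg_apply]

theorem tendsto_matrix_inv {ι : Type*} {l : Filter ι} {p : ℕ}
    {M : ι → Matrix (Fin p) (Fin p) ℝ} {M₀ : Matrix (Fin p) (Fin p) ℝ}
    (h : Tendsto M l (𝓝 M₀)) (hu : IsUnit M₀) : Tendsto (fun i => (M i)⁻¹) l (𝓝 M₀⁻¹) := by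
  obtain ⟨x, rfl⟩ := hu
  have h2 := (NormedRing.inverse_continuousAt x).tendsto.comp h
  rw [Matrix.nonsing_inv_eq_ringInverse]
  exact h2.congr fun i => (Matrix.nonsing_inv_eq_ringInverse _).symm

end Norm

theorem HasEntryDerivAt.mul {ι κ μ : Type*} [Fintype κ] {M : ℝ → Matrix ι κ ℝ}
    {N : ℝ → Matrix κ μ ℝ} {M' : Matrix ι κ ℝ} {N' : Matrix κ μ ℝ} {t : ℝ}
    (hM : HasEntryDerivAt M M' t) (hN : HasEntryDerivAt N N' t) :
    HasEntryDerivAt (fun s => M s * N s) (M' * N t + M t * N') t := by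
  intro a b
  simp only [Matrix.mul_apply, Matrix.add_apply, ← Finset.sum_add_distrib]
  exact HasDerivAt.fun_sum fun c _ => (hM a c).mul (hN c b)

theorem hasEntryDerivAt_const {ι κ : Type*} (M : Matrix ι κ ℝ) (t : ℝ) :
    HasEntryDerivAt (fun _ => M) 0 t := fun _ _ => hasDerivAt_const _ _

theorem HasEntryDerivAt.const_add_smul {ι κ : Type*} {M : ℝ → Matrix ι κ ℝ} {M' : Matrix ι κ ℝ}
    {t : ℝ} (h : HasEntryDerivAt M M' t) (C : Matrix ι κ ℝ) (c : ℝ) :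
    HasEntryDerivAt (fun s => C + c • M s) (c • M') t := fun a b => by
  simpa using ((h a b).const_mul c).const_add (C a b)

theorem HasEntryDerivAt.mulVec {ι κ : Type*} [Fintype κ] {M : ℝ → Matrix ι κ ℝ}
    {M' : Matrix ι κ ℝ} {t : ℝ} (h : HasEntryDerivAt M M' t) (v : κ → ℝ) (a : ι) :
    HasDerivAt (fun s => (M s *ᵥ v) a) ((M' *ᵥ v) a) t := by
  simp only [Matrix.mulVec, dotProduct]
  exact HasDerivAt.fun_sum fun c _ => (h a c).mul_const _

/-! ### Gradients of the criterion and of the limiting risk -/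

/-- The regularized Gram matrix `XᵀX + σ²K⁻¹`. -/
noncomputable def gram {ι : Type*} [Fintype ι] {p : ℕ} (σ : ℝ) (X : Matrix ι (Fin p) ℝ)
    (K : Matrix (Fin p) (Fin p) ℝ) : Matrix (Fin p) (Fin p) ℝ :=
  Xᵀ * X + σ ^ 2 • K⁻¹

theorem gram_posDef {ι : Type*} [Fintype ι] {p : ℕ} {σ : ℝ} (hσ : 0 < σ)
    (X : Matrix ι (Fin p) ℝ) {K : Matrix (Fin p) (Fin p) ℝ} (hK : K.PosDef) :
    (gram σ X K).PosDef := by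
  have h1 : (Xᵀ * X).PosSemidef := by
    simpa [Matrix.conjTranspose_eq_transpose_of_trivial] using
      Matrix.posSemidef_conjTranspose_mul_self X
  exact (Matrix.PosDef.posSemidef_add h1 (hK.inv.smul (by positivity)))

theorem transpose_eq_of_posDef {p : ℕ} {K : Matrix (Fin p) (Fin p) ℝ} (hK : K.PosDef) :
    Kᵀ = K := by
  simpa [Matrix.IsHermitian, Matrix.conjTranspose_eq_transpose_of_trivial] using hK.isHermitian

theorem hasDerivAt_rls {ι : Type*} [Fintype ι] {p : ℕ} {σ : ℝ} (hσ : 0 < σ)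
    (X : Matrix ι (Fin p) ℝ) (y : ι → ℝ) {M : ℝ → Matrix (Fin p) (Fin p) ℝ}
    {M' : Matrix (Fin p) (Fin p) ℝ} {t : ℝ} (h : HasEntryDerivAt M M' t) (hM : (M t).PosDef)
    (a : Fin p) :
    HasDerivAt (fun s => rls σ X y (M s) a)
      ((((σ ^ 2) • ((gram σ X (M t))⁻¹ * (M t)⁻¹ * M' * (M t)⁻¹)) *ᵥ rls σ X y (M t)) a) t := by
  -- The rule for inverses is applied twice, to `M` and to the Gram matrix; the two minus signs
  -- cancel.
  have h1 := ((h.inv hM.isUnit).const_add_smul (Xᵀ * X) (σ ^ 2)).inv (gram_posDef hσ X hM).isUnit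
  refine (h1.mulVec (Xᵀ *ᵥ y) a).congr_deriv ?_
  rw [rls, Matrix.mulVec_mulVec]
  simp [Matrix.mul_assoc, gram]

/-- The gradient of `ape` with respect to `K`, at a symmetric matrix `K`. -/
noncomputable def apeGrad {n p : ℕ} (σ : ℝ) (X : Matrix (Fin n) (Fin p) ℝ) (y : Fin n → ℝ)
    (s : Finset (Fin n)) (K : Matrix (Fin p) (Fin p) ℝ) : Matrix (Fin p) (Fin p) ℝ :=
  (-(2 * σ ^ 2) / s.card) • vecMulVec
    ((K⁻¹ * (gram σ (rows X sᶜ) K)⁻¹) *ᵥ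
      ((rows X s)ᵀ *ᵥ (entries y s - rows X s *ᵥ rls σ (rows X sᶜ) (entries y sᶜ) K)))
    (K⁻¹ *ᵥ rls σ (rows X sᶜ) (entries y sᶜ) K)

theorem sum_vecMulVec_mul {p : ℕ} (v w : Fin p → ℝ) (H : Matrix (Fin p) (Fin p) ℝ) :
    ∑ a, ∑ b, vecMulVec v w a b * H a b = v ⬝ᵥ (H *ᵥ w) := by
  simp only [vecMulVec_apply, dotProduct, Matrix.mulVec, Finset.mul_sum]
  exact Finset.sum_congr rfl fun a _ => Finset.sum_congr rfl fun b _ => by ring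

/-- The direction `M'` enters through a single bilinear expression in the residual and the
estimator, so the gradient is a multiple of a `vecMulVec`. Symmetry of `(M t)⁻¹` and of the inverse
Gram matrix moves both to the residual side; the direction `M'` itself may be arbitrary. -/
theorem hasDerivAt_ape {n p : ℕ} {σ : ℝ} (hσ : 0 < σ) (X : Matrix (Fin n) (Fin p) ℝ)
    (y : Fin n → ℝ) (s : Finset (Fin n)) {M : ℝ → Matrix (Fin p) (Fin p) ℝ}
    {M' : Matrix (Fin p) (Fin p) ℝ} {t : ℝ} (h : HasEntryDerivAt M M' t) (hM : (M t).PosDef) :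
    HasDerivAt (fun r => ape σ X y s (M r))
      (∑ a, ∑ b, apeGrad σ X y s (M t) a b * M' a b) t := by
  set g := rls σ (rows X sᶜ) (entries y sᶜ) (M t) with hg
  set A := gram σ (rows X sᶜ) (M t) with hA
  set L := ((σ ^ 2) • (A⁻¹ * (M t)⁻¹ * M' * (M t)⁻¹)) *ᵥ g with hL
  set e := entries y s - rows X s *ᵥ g with he
  have hb := hasDerivAt_rls hσ (rows X sᶜ) (entries y sᶜ) h hM
  have h1 : ∀ i : s, HasDerivAt
      (fun r => (entries y s - rows X s *ᵥ rls σ (rows X sᶜ) (entries y sᶜ) (M r)) i)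
      (-((rows X s *ᵥ L) i)) t := by
    intro i
    have : HasDerivAt (fun r => (rows X s *ᵥ rls σ (rows X sᶜ) (entries y sᶜ) (M r)) i)
        ((rows X s *ᵥ L) i) t := by
      simp only [Matrix.mulVec, dotProduct]
      exact HasDerivAt.fun_sum fun c _ => (hb c).const_mul _
    simpa using this.const_sub (entries y s i)
  have h2 := (HasDerivAt.fun_sum (u := Finset.univ) fun i _ => (h1 i).pow 2).const_mul
    ((s.card : ℝ)⁻¹)
  have h3 : HasDerivAt (fun r => ape σ X y s (M r)) ((s.card : ℝ)⁻¹ *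
      ∑ i : s, (2 * e i * (-((rows X s *ᵥ L) i)))) t := by
    refine h2.congr_deriv ?_
    simp [he, hg]
  refine h3.congr_deriv ?_
  have h4 : ∑ i : s, (2 * e i * (-((rows X s *ᵥ L) i))) = -2 * (e ⬝ᵥ (rows X s *ᵥ L)) := by
    simp only [dotProduct, Finset.mul_sum]
    exact Finset.sum_congr rfl fun i _ => by ring
  have hKs := transpose_eq_of_posDef hM.inv
  have hAs := transpose_eq_of_posDef (gram_posDef hσ (rows X sᶜ) hM).inv
  have h5 : ((((M t)⁻¹ * A⁻¹) *ᵥ ((rows X s)ᵀ *ᵥ e)) ⬝ᵥ (M' *ᵥ ((M t)⁻¹ *ᵥ g))) =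
      e ⬝ᵥ (rows X s *ᵥ ((A⁻¹ * (M t)⁻¹ * M' * (M t)⁻¹) *ᵥ g)) := by
    have h6 : (((M t)⁻¹ * A⁻¹) *ᵥ ((rows X s)ᵀ *ᵥ e)) = e ᵥ* (rows X s * (A⁻¹ * (M t)⁻¹)) := by
      rw [← Matrix.mulVec_transpose, Matrix.mulVec_mulVec, Matrix.transpose_mul,
        Matrix.transpose_mul, hKs, hAs]
    rw [h6, Matrix.mulVec_mulVec, ← Matrix.dotProduct_mulVec, Matrix.mulVec_mulVec,
      Matrix.mulVec_mulVec]
    simp only [Matrix.mul_assoc]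
  rw [h4, hL, Matrix.smul_mulVec, Matrix.mulVec_smul, dotProduct_smul, ← h5,
    ← sum_vecMulVec_mul, smul_eq_mul]
  simp only [apeGrad, Matrix.smul_apply, smul_eq_mul, mul_assoc, ← Finset.mul_sum]
  simp only [← hg, ← hA, ← he]
  ring

/-- The gradient of `lkocv` with respect to `K`, at a symmetric matrix `K`. -/
noncomputable def lkocvGrad {n p : ℕ} (σ : ℝ) (k : ℕ) (X : Matrix (Fin n) (Fin p) ℝ) (y : Fin n → ℝ)
    (K : Matrix (Fin p) (Fin p) ℝ) : Matrix (Fin p) (Fin p) ℝ :=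
  (n.choose k : ℝ)⁻¹ • ∑ s ∈ Finset.powersetCard k (Finset.univ : Finset (Fin n)),
    apeGrad σ X y s K

theorem hasDerivAt_lkocv {n p : ℕ} {σ : ℝ} (hσ : 0 < σ) (k : ℕ) (X : Matrix (Fin n) (Fin p) ℝ)
    (y : Fin n → ℝ) {M : ℝ → Matrix (Fin p) (Fin p) ℝ}
    {M' : Matrix (Fin p) (Fin p) ℝ} {t : ℝ} (h : HasEntryDerivAt M M' t) (hM : (M t).PosDef) :
    HasDerivAt (fun r => lkocv σ k X y (M r))
      (∑ a, ∑ b, lkocvGrad σ k X y (M t) a b * M' a b) t := by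
  have h1 := (HasDerivAt.fun_sum (u := Finset.powersetCard k (Finset.univ : Finset (Fin n)))
    fun s _ => hasDerivAt_ape hσ X y s h hM).const_mul ((n.choose k : ℝ)⁻¹)
  refine h1.congr_deriv ?_
  simp only [lkocvGrad, Matrix.smul_apply, Matrix.sum_apply, smul_eq_mul, mul_assoc,
    ← Finset.mul_sum, Finset.sum_mul]
  congr 1
  rw [Finset.sum_comm]
  exact Finset.sum_congr rfl fun a _ => Finset.sum_comm

theorem hasEntryDerivAt_add_smul {p : ℕ} (K H : Matrix (Fin p) (Fin p) ℝ) (t : ℝ) :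
    HasEntryDerivAt (fun t : ℝ => K + t • H) H t := fun a b => by
  simpa using ((hasDerivAt_id t).mul_const (H a b)).const_add (K a b)

theorem sum_mul_single {p : ℕ} (D : Matrix (Fin p) (Fin p) ℝ) (i j : Fin p) :
    ∑ a, ∑ b, D a b * Matrix.single i j (1 : ℝ) a b = D i j := by
  rw [Finset.sum_eq_single i, Finset.sum_eq_single j]
  · simp
  · intro b _ hb; simp [hb.symm]
  · simp
  · intro a _ ha; simp [ha.symm]
  · simp

/-- The curve `K + t • single i j 1` picks out one entry of `D`. It leaves the symmetric matrices
when `i ≠ j`, which is why the derivative formulas ask for positive definiteness at the base point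
only. -/
theorem matrixDeriv_eq {p : ℕ} {f : Matrix (Fin p) (Fin p) ℝ → ℝ}
    {K D : Matrix (Fin p) (Fin p) ℝ}
    (h : ∀ (M : ℝ → Matrix (Fin p) (Fin p) ℝ) (M' : Matrix (Fin p) (Fin p) ℝ),
      HasEntryDerivAt M M' 0 → M 0 = K →
        HasDerivAt (fun r => f (M r)) (∑ a, ∑ b, D a b * M' a b) 0) :
    matrixDeriv f K = D := by
  ext i j
  have := (h _ _ (hasEntryDerivAt_add_smul K (Matrix.single i j 1) 0) (by simp)).deriv
  rw [sum_mul_single] at this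
  simpa [matrixDeriv] using this

theorem matrixDeriv_lkocv {n p : ℕ} {σ : ℝ} (hσ : 0 < σ) (k : ℕ) (X : Matrix (Fin n) (Fin p) ℝ)
    (y : Fin n → ℝ) {K : Matrix (Fin p) (Fin p) ℝ} (hK : K.PosDef) :
    matrixDeriv (lkocv σ k X y) K = lkocvGrad σ k X y K :=
  matrixDeriv_eq fun _ _ h h0 => by
    subst h0
    exact hasDerivAt_lkocv hσ k X y h hK

/-- The gradient of `limitRisk` with respect to `K`, at a symmetric matrix `K`. -/
noncomputable def limitRiskGrad {p : ℕ} (β : Fin p → ℝ) (Sig K : Matrix (Fin p) (Fin p) ℝ) :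
    Matrix (Fin p) (Fin p) ℝ :=
  (2 : ℝ) • (K⁻¹ * Sig⁻¹ * K⁻¹) - vecMulVec (K⁻¹ *ᵥ β) ((K⁻¹ * Sig⁻¹ * K⁻¹) *ᵥ β) -
    vecMulVec ((K⁻¹ * Sig⁻¹ * K⁻¹) *ᵥ β) (K⁻¹ *ᵥ β)

theorem sum_mul_eq_trace {p : ℕ} (D H : Matrix (Fin p) (Fin p) ℝ) :
    ∑ a, ∑ b, D a b * H a b = (D * Hᵀ).trace := by
  simp [Matrix.trace, Matrix.mul_apply]

theorem hasDerivAt_limitRisk {p : ℕ} (β : Fin p → ℝ) {Sig : Matrix (Fin p) (Fin p) ℝ}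
    (hSig : Sig.PosDef) {M : ℝ → Matrix (Fin p) (Fin p) ℝ}
    {M' : Matrix (Fin p) (Fin p) ℝ} {t : ℝ} (h : HasEntryDerivAt M M' t) (hM : (M t).PosDef) :
    HasDerivAt (fun r => limitRisk β Sig (M r))
      (∑ a, ∑ b, limitRiskGrad β Sig (M t) a b * M' a b) t := by
  have hi := h.inv hM.isUnit
  have hc := hasEntryDerivAt_const Sig⁻¹ t
  have h1 := (hi.mul hc).mul hi
  have h2 := hc.mul hi
  have h3 : HasDerivAt (fun r => β ⬝ᵥ (((M r)⁻¹ * Sig⁻¹ * (M r)⁻¹) *ᵥ β)) _ t :=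
    HasDerivAt.fun_sum fun a _ => (h1.mulVec β a).const_mul (β a)
  have h4 : HasDerivAt (fun r => (Sig⁻¹ * (M r)⁻¹).trace) _ t :=
    HasDerivAt.fun_sum fun a _ => h2 a a
  refine (h3.sub (h4.const_mul 2)).congr_deriv (Eq.symm ?_)
  set J := (M t)⁻¹ with hJ
  have hJs : Jᵀ = J := transpose_eq_of_posDef hM.inv
  have hSs : (Sig⁻¹)ᵀ = Sig⁻¹ := transpose_eq_of_posDef hSig.inv
  set Q := J * Sig⁻¹ * J with hQ
  have hQs : Qᵀ = Q := by rw [hQ]; simp [Matrix.transpose_mul, hJs, hSs, Matrix.mul_assoc]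
  have e1 : ∑ a, ∑ b, limitRiskGrad β Sig (M t) a b * M' a b =
      2 * (Q * M'ᵀ).trace - (J *ᵥ β) ⬝ᵥ (M' *ᵥ (Q *ᵥ β)) - (Q *ᵥ β) ⬝ᵥ (M' *ᵥ (J *ᵥ β)) := by
    rw [← sum_vecMulVec_mul, ← sum_vecMulVec_mul, ← sum_mul_eq_trace]
    simp only [limitRiskGrad, ← hJ, ← hQ, Matrix.sub_apply, Matrix.smul_apply, sub_mul,
      Finset.sum_sub_distrib, smul_eq_mul, mul_assoc, Finset.mul_sum]
  rw [e1]
  -- Since `Q` is symmetric, transposing inside the trace removes the transpose from `M'`.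
  have e2 : (Q * M'ᵀ).trace = (J * Sig⁻¹ * J * M').trace := by
    rw [← Matrix.trace_transpose, Matrix.transpose_mul, hQs, Matrix.transpose_transpose,
      Matrix.trace_mul_comm]
  have key : ∀ v w : Fin p → ℝ, ∀ N : Matrix (Fin p) (Fin p) ℝ, Nᵀ = N →
      (N *ᵥ v) ⬝ᵥ w = v ⬝ᵥ (N *ᵥ w) := by
    intro v w N hN
    rw [Matrix.dotProduct_mulVec, ← Matrix.mulVec_transpose, hN]
  rw [e2, key _ _ J hJs, key _ _ Q hQs]
  have e3 : ∀ N : Matrix (Fin p) (Fin p) ℝ,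
      ∑ a, β a * (N *ᵥ β) a = β ⬝ᵥ (N *ᵥ β) := fun N => rfl
  have e4 : ∀ N : Matrix (Fin p) (Fin p) ℝ, ∑ a, N a a = N.trace := fun N => rfl
  rw [e3, e4]
  simp only [Matrix.mulVec_mulVec, Matrix.mul_zero, Matrix.zero_mul, add_zero, zero_add,
    Matrix.add_mulVec, dotProduct_add, Matrix.neg_mul, Matrix.mul_neg, Matrix.neg_mulVec,
    dotProduct_neg, Matrix.trace_neg]
  have e5 : (Sig⁻¹ * (J * M' * J)).trace = (J * Sig⁻¹ * J * M').trace := by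
    rw [← Matrix.mul_assoc, Matrix.trace_mul_comm]
    simp only [Matrix.mul_assoc]
  rw [e5, hQ]
  simp only [Matrix.mul_assoc]
  ring

theorem matrixDeriv_limitRisk {p : ℕ} (β : Fin p → ℝ) {Sig K : Matrix (Fin p) (Fin p) ℝ}
    (hSig : Sig.PosDef) (hK : K.PosDef) :
    matrixDeriv (limitRisk β Sig) K = limitRiskGrad β Sig K :=
  matrixDeriv_eq fun _ _ h h0 => by
    subst h0
    exact hasDerivAt_limitRisk β hSig h hK


/-! ### Averages over blocks: sampling without replacement -/

/-- The mean of `f` over all blocks of size `k`. -/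
noncomputable def blockAvg {n : ℕ} (k : ℕ) (f : Finset (Fin n) → ℝ) : ℝ :=
  (n.choose k : ℝ)⁻¹ * ∑ s ∈ Finset.powersetCard k (Finset.univ : Finset (Fin n)), f s

section blockAvg
variable {n k : ℕ}

theorem blockAvg_add (f g : Finset (Fin n) → ℝ) :
    blockAvg k (fun s => f s + g s) = blockAvg k f + blockAvg k g := by
  simp [blockAvg, Finset.sum_add_distrib, mul_add]

theorem blockAvg_sub (f g : Finset (Fin n) → ℝ) :
    blockAvg k (fun s => f s - g s) = blockAvg k f - blockAvg k g := by
  simp [blockAvg, Finset.sum_sub_distrib, mul_sub]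

theorem blockAvg_const_mul (c : ℝ) (f : Finset (Fin n) → ℝ) :
    blockAvg k (fun s => c * f s) = c * blockAvg k f := by
  simp only [blockAvg, ← Finset.mul_sum]; ring

theorem blockAvg_sum {ι : Type*} (t : Finset ι) (f : ι → Finset (Fin n) → ℝ) :
    blockAvg k (fun s => ∑ i ∈ t, f i s) = ∑ i ∈ t, blockAvg k (f i) := by
  simp only [blockAvg, ← Finset.mul_sum]
  rw [Finset.sum_comm]

theorem blockAvg_congr {f g : Finset (Fin n) → ℝ} (h : ∀ s, s.card = k → f s = g s) :
    blockAvg k f = blockAvg k g := by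
  unfold blockAvg
  rw [Finset.sum_congr rfl fun s hs => h s (Finset.mem_powersetCard.1 hs).2]

theorem blockAvg_mono {f g : Finset (Fin n) → ℝ} (h : ∀ s, s.card = k → f s ≤ g s) :
    blockAvg k f ≤ blockAvg k g :=
  mul_le_mul_of_nonneg_left
    (Finset.sum_le_sum fun s hs => h s (Finset.mem_powersetCard.1 hs).2) (by positivity)

theorem abs_blockAvg_le (f : Finset (Fin n) → ℝ) :
    |blockAvg k f| ≤ blockAvg k (fun s => |f s|) := by
  unfold blockAvg
  rw [abs_mul, abs_of_nonneg (by positivity : (0 : ℝ) ≤ (n.choose k : ℝ)⁻¹)]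
  gcongr
  exact Finset.abs_sum_le_sum_abs _ _

/-- There are `(n - 1).choose (k - 1)` blocks containing `i`, and `n * (n - 1).choose (k - 1) = k *
n.choose k`. For a pair of points the same identity is used twice. -/
theorem blockAvg_mem (hk : 1 ≤ k) (hn : k ≤ n) (i : Fin n) :
    blockAvg k (fun s => if i ∈ s then (1 : ℝ) else 0) = k / n := by
  have h := Finset.card_filter_powersetCard_subset ({i} : Finset (Fin n)) Finset.univ k
    (by simp) (by simpa using hk)
  simp only [Finset.singleton_subset_iff, Finset.card_univ, Fintype.card_fin,
    Finset.card_singleton] at h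
  rw [blockAvg, Finset.sum_boole, h]
  obtain ⟨n, rfl⟩ : ∃ n', n = n' + 1 := ⟨n - 1, by omega⟩
  obtain ⟨k, rfl⟩ : ∃ k', k = k' + 1 := ⟨k - 1, by omega⟩
  have h1 : ((n + 1) * n.choose k : ℝ) = (n + 1).choose (k + 1) * (k + 1) := by
    exact_mod_cast Nat.add_one_mul_choose_eq n k
  have h2 : ((n + 1).choose (k + 1) : ℝ) ≠ 0 := by
    exact_mod_cast (Nat.choose_pos hn).ne'
  simp only [Nat.add_sub_cancel]
  push_cast
  field_simp
  linarith

theorem blockAvg_mem_mem (hk : 1 ≤ k) (hn : k < n) {i j : Fin n} (hij : i ≠ j) :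
    blockAvg k (fun s => if i ∈ s ∧ j ∈ s then (1 : ℝ) else 0) =
      k * (k - 1) / (n * (n - 1)) := by
  -- A block of one element contains no pair; the count of blocks containing a pair needs `2 ≤ k`.
  obtain rfl | hk2 : k = 1 ∨ 2 ≤ k := by omega
  · have : blockAvg 1 (fun s => if i ∈ s ∧ j ∈ s then (1 : ℝ) else 0) =
        blockAvg 1 (fun _ : Finset (Fin n) => 0) := by
      refine blockAvg_congr fun s hs => if_neg fun h => hij ?_
      obtain ⟨a, rfl⟩ := Finset.card_eq_one.1 hs
      simp only [Finset.mem_singleton] at h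
      exact h.1.trans h.2.symm
    rw [this]
    simp [blockAvg]
  have h := Finset.card_filter_powersetCard_subset ({i, j} : Finset (Fin n)) Finset.univ k
    (by simp) (by rwa [Finset.card_pair hij])
  simp only [Finset.insert_subset_iff, Finset.singleton_subset_iff, Finset.card_univ,
    Fintype.card_fin, Finset.card_pair hij] at h
  rw [blockAvg, Finset.sum_boole, h]
  obtain ⟨n, rfl⟩ : ∃ n', n = n' + 2 := ⟨n - 2, by omega⟩
  obtain ⟨k, rfl⟩ : ∃ k', k = k' + 2 := ⟨k - 2, by omega⟩
  have h1 : ((n + 1) * n.choose k : ℝ) = (n + 1).choose (k + 1) * (k + 1) := by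
    exact_mod_cast Nat.add_one_mul_choose_eq n k
  have h1' : ((n + 1 + 1) * (n + 1).choose (k + 1) : ℝ) =
      (n + 2).choose (k + 2) * (k + 1 + 1) := by
    exact_mod_cast Nat.add_one_mul_choose_eq (n + 1) (k + 1)
  have h2 : ((n + 2).choose (k + 2) : ℝ) ≠ 0 := by
    exact_mod_cast (Nat.choose_pos hn.le).ne'
  have h3 : ((n : ℝ) + 2 - 1) ≠ 0 := by
    have : (0 : ℝ) ≤ n := n.cast_nonneg
    linarith
  simp only [Nat.add_sub_cancel]
  push_cast
  field_simp
  linear_combination ((n : ℝ) + 2) * h1 + ((k : ℝ) + 1) * h1'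

theorem blockAvg_sum_mem (hk : 1 ≤ k) (hn : k ≤ n) (f : Fin n → ℝ) :
    blockAvg k (fun s => ∑ i ∈ s, f i) = k / n * ∑ i, f i := by
  have : ∀ s : Finset (Fin n), ∑ i ∈ s, f i = ∑ i, f i * (if i ∈ s then (1 : ℝ) else 0) := by
    intro s
    simp
  rw [funext this]
  simp_rw [blockAvg_sum, blockAvg_const_mul, blockAvg_mem hk hn, ← Finset.sum_mul]
  exact mul_comm _ _

/-- The mean over all blocks of a product of two block sums. -/
theorem blockAvg_sum_mul_sum (hk : 1 ≤ k) (hn : k < n) (f g : Fin n → ℝ) :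
    blockAvg k (fun s => (∑ i ∈ s, f i) * ∑ i ∈ s, g i) =
      k * (n - k) / (n * (n - 1)) * ∑ i, f i * g i +
        k * (k - 1) / (n * (n - 1)) * ((∑ i, f i) * ∑ i, g i) := by
  have h1 : ∀ s : Finset (Fin n), (∑ i ∈ s, f i) * ∑ i ∈ s, g i =
      ∑ i, ∑ j, (f i * g j) * (if i ∈ s ∧ j ∈ s then (1 : ℝ) else 0) := by
    intro s
    have e : ∀ f : Fin n → ℝ, ∑ i ∈ s, f i = ∑ i, f i * (if i ∈ s then (1 : ℝ) else 0) := by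
      intro f; simp
    rw [e, e, Finset.sum_mul_sum]
    refine Finset.sum_congr rfl fun i _ => Finset.sum_congr rfl fun j _ => ?_
    by_cases hi : i ∈ s <;> by_cases hj : j ∈ s <;> simp [hi, hj]
  have hn0 : (n : ℝ) ≠ 0 := by
    have : 0 < n := by omega
    positivity
  have hn1 : (n : ℝ) - 1 ≠ 0 := by
    have : (1 : ℝ) < n := by exact_mod_cast (by omega : 1 < n)
    linarith
  -- On the diagonal the inclusion frequency is `k / n`, which exceeds that of a pair by `k (n - k)
  -- / (n (n - 1))`. This excess is the coefficient of `∑ f g`.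
  have h2 : ∀ i j : Fin n, blockAvg k (fun s => if i ∈ s ∧ j ∈ s then (1 : ℝ) else 0) =
      k * (k - 1) / (n * (n - 1)) +
        (if i = j then (k * (n - k) / (n * (n - 1)) : ℝ) else 0) := by
    intro i j
    by_cases hij : i = j
    · subst hij
      simp only [and_self, if_true]
      rw [blockAvg_mem hk hn.le]
      field_simp
      ring
    · rw [blockAvg_mem_mem hk hn hij, if_neg hij, add_zero]
  rw [funext h1]
  simp_rw [blockAvg_sum, blockAvg_const_mul, h2, mul_add, Finset.sum_add_distrib,
    mul_ite, mul_zero, Finset.sum_ite_eq, Finset.mem_univ, if_true]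
  rw [Finset.sum_mul_sum, add_comm]
  simp_rw [Finset.mul_sum]
  congr 1
  · exact Finset.sum_congr rfl fun i _ => by ring
  · exact Finset.sum_congr rfl fun i _ => Finset.sum_congr rfl fun j _ => by ring

end blockAvg

/-! ### Exact leave-out identities -/

section Algebra
variable {n p : ℕ}

/-- The deviation of the full-data regularized least squares estimator from `β`, where the data
are `X β + e`. -/
noncomputable def fitError (σ : ℝ) (β : Fin p → ℝ) (X : Matrix (Fin n) (Fin p) ℝ) (e : Fin n → ℝ)
    (K : Matrix (Fin p) (Fin p) ℝ) : Fin p → ℝ :=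
  (gram σ X K)⁻¹ *ᵥ (Xᵀ *ᵥ e - σ ^ 2 • (K⁻¹ *ᵥ β))

/-- The covariate vector of an observation times its full-data residual. -/
noncomputable def score (σ : ℝ) (β : Fin p → ℝ) (X : Matrix (Fin n) (Fin p) ℝ) (e : Fin n → ℝ)
    (K : Matrix (Fin p) (Fin p) ℝ) (j : Fin n) (a : Fin p) : ℝ :=
  X j a * (e j - X j ⬝ᵥ fitError σ β X e K)

/-- The sum of the scores over a block. -/
noncomputable def blockScore (σ : ℝ) (β : Fin p → ℝ) (X : Matrix (Fin n) (Fin p) ℝ)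
    (e : Fin n → ℝ) (K : Matrix (Fin p) (Fin p) ℝ) (s : Finset (Fin n)) (a : Fin p) : ℝ :=
  ∑ j ∈ s, score σ β X e K j a

theorem rows_gram_apply (X : Matrix (Fin n) (Fin p) ℝ) (s : Finset (Fin n)) (a b : Fin p) :
    ((rows X s)ᵀ * rows X s) a b = ∑ j ∈ s, X j a * X j b := by
  simp only [Matrix.mul_apply, Matrix.transpose_apply, rows, Matrix.submatrix_apply, id]
  exact Finset.sum_coe_sort s fun j => X j a * X j b

theorem rows_transpose_mulVec_apply (X : Matrix (Fin n) (Fin p) ℝ) (y : Fin n → ℝ)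
    (s : Finset (Fin n)) (a : Fin p) :
    ((rows X s)ᵀ *ᵥ entries y s) a = ∑ j ∈ s, X j a * y j := by
  simp only [Matrix.mulVec, dotProduct, Matrix.transpose_apply, rows, entries,
    Matrix.submatrix_apply, id]
  exact Finset.sum_coe_sort s fun j => X j a * y j

theorem gram_rows_compl (σ : ℝ) (X : Matrix (Fin n) (Fin p) ℝ) (s : Finset (Fin n))
    (K : Matrix (Fin p) (Fin p) ℝ) :
    gram σ (rows X sᶜ) K = gram σ X K - (rows X s)ᵀ * rows X s := by
  ext a b
  simp only [gram, Matrix.sub_apply, Matrix.add_apply, rows_gram_apply]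
  rw [Matrix.mul_apply, ← Finset.sum_add_sum_compl s]
  simp only [Matrix.transpose_apply]
  ring

theorem rows_transpose_mulVec_compl (X : Matrix (Fin n) (Fin p) ℝ) (y : Fin n → ℝ)
    (s : Finset (Fin n)) :
    (rows X sᶜ)ᵀ *ᵥ entries y sᶜ = Xᵀ *ᵥ y - (rows X s)ᵀ *ᵥ entries y s := by
  ext a
  simp only [Pi.sub_apply, rows_transpose_mulVec_apply]
  rw [Matrix.mulVec, dotProduct, ← Finset.sum_add_sum_compl s]
  simp only [Matrix.transpose_apply]
  ring

theorem entries_mulVec_add (X : Matrix (Fin n) (Fin p) ℝ) (β : Fin p → ℝ) (e : Fin n → ℝ)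
    (s : Finset (Fin n)) :
    entries (X *ᵥ β + e) s = rows X s *ᵥ β + entries e s := rfl

theorem blockScore_eq (σ : ℝ) (β : Fin p → ℝ) (X : Matrix (Fin n) (Fin p) ℝ)
    (e : Fin n → ℝ) (K : Matrix (Fin p) (Fin p) ℝ) (s : Finset (Fin n)) :
    blockScore σ β X e K s = (rows X s)ᵀ *ᵥ entries e s -
      ((rows X s)ᵀ * rows X s) *ᵥ fitError σ β X e K := by
  ext a
  simp only [blockScore, score, Pi.sub_apply, rows_transpose_mulVec_apply, mul_sub,
    Finset.sum_sub_distrib]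
  congr 1
  simp only [Matrix.mulVec, dotProduct, rows_gram_apply, Finset.sum_mul, Finset.mul_sum]
  rw [Finset.sum_comm]
  exact Finset.sum_congr rfl fun i _ => Finset.sum_congr rfl fun j _ => by ring

theorem gram_mulVec_fitError {σ : ℝ} (hσ : 0 < σ) (β : Fin p → ℝ) (X : Matrix (Fin n) (Fin p) ℝ)
    (e : Fin n → ℝ) {K : Matrix (Fin p) (Fin p) ℝ} (hK : K.PosDef) :
    gram σ X K *ᵥ fitError σ β X e K = Xᵀ *ᵥ e - σ ^ 2 • (K⁻¹ *ᵥ β) := by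
  have hu := (Matrix.isUnit_iff_isUnit_det _).1 (gram_posDef hσ X hK).isUnit
  rw [fitError, Matrix.mulVec_mulVec, Matrix.mul_nonsing_inv _ hu, Matrix.one_mulVec]

/-- The normal equations: the score of the data is balanced by the penalty. The sum of all `n`
scores thus stays bounded, which gives the linear part of the gradient a finite limit at scale `n²`.
-/
theorem sum_score {σ : ℝ} (hσ : 0 < σ) (β : Fin p → ℝ) (X : Matrix (Fin n) (Fin p) ℝ)
    (e : Fin n → ℝ) {K : Matrix (Fin p) (Fin p) ℝ} (hK : K.PosDef) (a : Fin p) :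
    ∑ j, score σ β X e K j a = σ ^ 2 * (K⁻¹ *ᵥ (β + fitError σ β X e K)) a := by
  have h := congrFun (gram_mulVec_fitError hσ β X e hK) a
  have h2 : ∑ j, score σ β X e K j a =
      (Xᵀ *ᵥ e) a - ((Xᵀ * X) *ᵥ fitError σ β X e K) a := by
    simp only [score, mul_sub, Finset.sum_sub_distrib]
    congr 1
    rw [← Matrix.mulVec_mulVec]
    rfl
  rw [gram, Matrix.add_mulVec, Matrix.smul_mulVec] at h
  simp only [Pi.add_apply, Pi.smul_apply, Pi.sub_apply, smul_eq_mul] at h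
  rw [h2, Matrix.mulVec_add, Pi.add_apply]
  linarith

/-- Both sides are compared after multiplication by the training Gram matrix: deleting a block from
the full normal equations changes them by exactly the block score. -/
theorem rls_compl_eq {σ : ℝ} (hσ : 0 < σ) (β : Fin p → ℝ) (X : Matrix (Fin n) (Fin p) ℝ)
    (e : Fin n → ℝ) {K : Matrix (Fin p) (Fin p) ℝ} (hK : K.PosDef) (s : Finset (Fin n)) :
    rls σ (rows X sᶜ) (entries (X *ᵥ β + e) sᶜ) K =
      β + fitError σ β X e K - (gram σ (rows X sᶜ) K)⁻¹ *ᵥ blockScore σ β X e K s := by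
  set A := gram σ (rows X sᶜ) K with hA
  set u := fitError σ β X e K with hu
  have hAu := (Matrix.isUnit_iff_isUnit_det _).1 (gram_posDef hσ (rows X sᶜ) hK).isUnit
  have h1 : A *ᵥ (β + u - A⁻¹ *ᵥ blockScore σ β X e K s) =
      (rows X sᶜ)ᵀ *ᵥ entries (X *ᵥ β + e) sᶜ := by
    rw [Matrix.mulVec_sub, Matrix.mulVec_mulVec, Matrix.mul_nonsing_inv _ hAu,
      Matrix.one_mulVec, blockScore_eq, Matrix.mulVec_add, entries_mulVec_add, Matrix.mulVec_add,
      rows_transpose_mulVec_compl, ← hu]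
    have h2 : A *ᵥ u = Xᵀ *ᵥ e - σ ^ 2 • (K⁻¹ *ᵥ β) - ((rows X s)ᵀ * rows X s) *ᵥ u := by
      rw [hA, gram_rows_compl, Matrix.sub_mulVec, hu, gram_mulVec_fitError hσ β X e hK]
    rw [h2, hA, gram, Matrix.add_mulVec, Matrix.smul_mulVec, Matrix.mulVec_mulVec]
    abel
  rw [rls, ← h1, Matrix.mulVec_mulVec]
  change (A⁻¹ * A) *ᵥ _ = _
  rw [Matrix.nonsing_inv_mul _ hAu, Matrix.one_mulVec]

/-- By `rls_compl_eq` the left side is `E + X_sᵀX_s A⁻¹ E`, and the training Gram matrix `A` plus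
`X_sᵀX_s` is the full Gram matrix. -/
theorem residual_score_eq {σ : ℝ} (hσ : 0 < σ) (β : Fin p → ℝ) (X : Matrix (Fin n) (Fin p) ℝ)
    (e : Fin n → ℝ) {K : Matrix (Fin p) (Fin p) ℝ} (hK : K.PosDef) (s : Finset (Fin n)) :
    (rows X s)ᵀ *ᵥ (entries (X *ᵥ β + e) s -
        rows X s *ᵥ rls σ (rows X sᶜ) (entries (X *ᵥ β + e) sᶜ) K) =
      (gram σ X K * (gram σ (rows X sᶜ) K)⁻¹) *ᵥ blockScore σ β X e K s := by
  rw [rls_compl_eq hσ β X e hK]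
  have hAu := (Matrix.isUnit_iff_isUnit_det _).1 (gram_posDef hσ (rows X sᶜ) hK).isUnit
  have h1 : gram σ X K = gram σ (rows X sᶜ) K + (rows X s)ᵀ * rows X s := by
    rw [gram_rows_compl]; abel
  rw [h1, Matrix.add_mul, Matrix.mul_nonsing_inv _ hAu, Matrix.add_mulVec, Matrix.one_mulVec]
  conv_rhs => rw [blockScore_eq]
  rw [entries_mulVec_add]
  simp only [Matrix.mulVec_sub, Matrix.mulVec_add, Matrix.mulVec_mulVec, Matrix.mul_assoc,
    blockScore_eq]
  abel

theorem vecMulVec_mul_of_transpose_eq {M : Matrix (Fin p) (Fin p) ℝ} (hM : Mᵀ = M) (v w : Fin p → ℝ) :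
    vecMulVec v w * M = vecMulVec v (M *ᵥ w) := by
  rw [← Matrix.transpose_transpose (vecMulVec v w * M), Matrix.transpose_mul, hM,
    Matrix.transpose_vecMulVec, Matrix.mul_vecMulVec, Matrix.transpose_vecMulVec]

/-- `n²` times the gradient of the average prediction error, in terms of the rescaled matrices
`n A⁻¹` and `n⁻¹ S`. -/
theorem sq_smul_apeGrad {σ : ℝ} (hσ : 0 < σ) (β : Fin p → ℝ) (X : Matrix (Fin n) (Fin p) ℝ)
    (e : Fin n → ℝ) {K : Matrix (Fin p) (Fin p) ℝ} (hK : K.PosDef) (s : Finset (Fin n))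
    (hn : n ≠ 0) {N q : Matrix (Fin p) (Fin p) ℝ}
    (hN : N = (n : ℝ) • (gram σ (rows X sᶜ) K)⁻¹) (hq : q = (n : ℝ)⁻¹ • gram σ X K) :
    (n : ℝ) ^ 2 • apeGrad σ X (X *ᵥ β + e) s K = (-(2 * σ ^ 2)) • (K⁻¹ *
      (vecMulVec ((n / s.card : ℝ) • ((N * q * N) *ᵥ blockScore σ β X e K s))
          (β + fitError σ β X e K) -
        (N * q * N) * ((s.card : ℝ)⁻¹ • vecMulVec (blockScore σ β X e K s)
          (blockScore σ β X e K s)) * N) * K⁻¹) := by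
  have hKs := transpose_eq_of_posDef hK.inv
  have hAs := transpose_eq_of_posDef (gram_posDef hσ (rows X sᶜ) hK).inv
  have hn' : (n : ℝ) ≠ 0 := by exact_mod_cast hn
  rw [apeGrad, residual_score_eq hσ β X e hK, rls_compl_eq hσ β X e hK]
  set A := (gram σ (rows X sᶜ) K)⁻¹
  set E := blockScore σ β X e K s
  set S := gram σ X K
  have hB : N * q * N = (n : ℝ) • (A * S * A) := by
    rw [hN, hq]
    simp only [Matrix.smul_mul, Matrix.mul_smul, smul_smul]
    congr 1
    field_simp
  rw [hB, hN]
  have e1 : vecMulVec ((n / s.card : ℝ) • (((n : ℝ) • (A * S * A)) *ᵥ E))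
      (β + fitError σ β X e K) = ((n : ℝ) ^ 2 / s.card) •
        vecMulVec ((A * S * A) *ᵥ E) (β + fitError σ β X e K) := by
    rw [Matrix.smul_mulVec, smul_smul, Matrix.smul_vecMulVec]
    congr 1
    ring
  have e2 : ((n : ℝ) • (A * S * A)) * ((s.card : ℝ)⁻¹ • vecMulVec E E) * ((n : ℝ) • A) =
      ((n : ℝ) ^ 2 / s.card) • vecMulVec ((A * S * A) *ᵥ E) (A *ᵥ E) := by
    simp only [Matrix.smul_mul, Matrix.mul_smul, smul_smul]
    rw [Matrix.mul_vecMulVec, vecMulVec_mul_of_transpose_eq hAs]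
    congr 1
    ring
  rw [e1, e2, ← smul_sub, Matrix.mul_smul, Matrix.smul_mul, smul_smul, smul_smul,
    ← Matrix.vecMulVec_sub, Matrix.mul_vecMulVec, vecMulVec_mul_of_transpose_eq hKs]
  simp only [Matrix.mulVec_mulVec, Matrix.mul_assoc]
  congr 1
  ring

theorem blockAvg_mul_mul (k : ℕ) (M N : Matrix (Fin p) (Fin p) ℝ)
    (D : Finset (Fin n) → Matrix (Fin p) (Fin p) ℝ) (a b : Fin p) :
    blockAvg k (fun s => (M * D s * N) a b) =
      (M * (Matrix.of fun c d => blockAvg k fun s => D s c d) * N) a b := by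
  simp only [Matrix.mul_apply, Finset.sum_mul, Matrix.of_apply]
  rw [blockAvg_sum]
  refine Finset.sum_congr rfl fun c _ => ?_
  rw [blockAvg_sum]
  refine Finset.sum_congr rfl fun d _ => ?_
  rw [mul_right_comm, ← blockAvg_const_mul]
  exact blockAvg_congr fun s _ => by ring

theorem lkocvGrad_apply (σ : ℝ) (k : ℕ) (X : Matrix (Fin n) (Fin p) ℝ) (y : Fin n → ℝ)
    (K : Matrix (Fin p) (Fin p) ℝ) (a b : Fin p) :
    lkocvGrad σ k X y K a b = blockAvg k fun s => apeGrad σ X y s K a b := by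
  simp [lkocvGrad, blockAvg, Matrix.sum_apply]

end Algebra

/-! ### Limits uniform over blocks -/

section BlockFilter
variable {ι : Type*} {l : Filter ι} {n : ι → ℕ} {k : ℕ → ℕ}

/-- The filter on pairs of an index and a block for which convergence is convergence along `l`,
uniformly over the blocks `s` of size `k`. -/
def blockFilter (l : Filter ι) (n : ι → ℕ) (k : ℕ → ℕ) : Filter (Σ i, Finset (Fin (n i))) :=
  comap Sigma.fst l ⊓ 𝓟 {j | j.2.card = k (n j.1)}

theorem eventually_blockFilter {Q : (Σ i, Finset (Fin (n i))) → Prop} :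
    (∀ᶠ j in blockFilter l n k, Q j) ↔
      ∀ᶠ i in l, ∀ s : Finset (Fin (n i)), s.card = k (n i) → Q ⟨i, s⟩ := by
  rw [blockFilter, eventually_inf_principal, eventually_comap]
  refine eventually_congr (Eventually.of_forall fun i => ⟨fun h s hs => h ⟨i, s⟩ rfl hs, ?_⟩)
  rintro h ⟨_, s⟩ rfl hs
  exact h s hs

theorem tendsto_fst_blockFilter : Tendsto Sigma.fst (blockFilter l n k) l :=
  tendsto_comap.mono_left inf_le_left

theorem eventually_fst_blockFilter {Q : ι → Prop} (h : ∀ᶠ i in l, Q i) :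
    ∀ᶠ j in blockFilter l n k, Q j.1 := tendsto_fst_blockFilter.eventually h

/-- Replacing `f` by its uniform limit costs a small multiple of the mean of `|t|`. The bound on
this absolute mean is a separate hypothesis because the mean of `t` may converge by cancellation
alone. -/
theorem tendsto_blockAvg_mul {f : (Σ i, Finset (Fin (n i))) → ℝ} {f₀ t₀ C : ℝ}
    {t : (i : ι) → Finset (Fin (n i)) → ℝ} (hf : Tendsto f (blockFilter l n k) (𝓝 f₀))
    (hC : ∀ᶠ i in l, blockAvg (k (n i)) (fun s => |t i s|) ≤ C)
    (ht : Tendsto (fun i => blockAvg (k (n i)) (t i)) l (𝓝 t₀)) :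
    Tendsto (fun i => blockAvg (k (n i)) fun s => f ⟨i, s⟩ * t i s) l (𝓝 (f₀ * t₀)) := by
  have h1 : Tendsto (fun i => blockAvg (k (n i)) fun s => (f ⟨i, s⟩ - f₀) * t i s) l (𝓝 0) := by
    rw [Metric.tendsto_nhds]
    intro δ hδ
    -- `|C| + 1` is a positive divisor whatever the sign of `C`.
    have hC' : 0 < |C| + 1 := by positivity
    have h2 : ∀ᶠ j in blockFilter l n k, |f j - f₀| < δ / (|C| + 1) := by
      simpa [Real.dist_eq] using (Metric.tendsto_nhds.1 hf) (δ / (|C| + 1)) (by positivity)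
    filter_upwards [eventually_blockFilter.1 h2, hC] with i hi hCi
    rw [Real.dist_eq, sub_zero]
    calc _ ≤ blockAvg (k (n i)) fun s => |(f ⟨i, s⟩ - f₀) * t i s| := abs_blockAvg_le _
      _ ≤ blockAvg (k (n i)) fun s => δ / (|C| + 1) * |t i s| := by
        refine blockAvg_mono fun s hs => ?_
        rw [abs_mul]
        exact mul_le_mul_of_nonneg_right (hi s hs).le (abs_nonneg _)
      _ = δ / (|C| + 1) * blockAvg (k (n i)) fun s => |t i s| := blockAvg_const_mul _ _
      _ ≤ δ / (|C| + 1) * |C| := by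
        have := le_abs_self C
        gcongr
        linarith
      _ < δ := by
        rw [div_mul_eq_mul_div, div_lt_iff₀ hC']
        nlinarith
  have h3 := h1.add (ht.const_mul f₀)
  rw [zero_add] at h3
  refine h3.congr fun i => ?_
  rw [← blockAvg_const_mul, ← blockAvg_add]
  exact blockAvg_congr fun s _ => by ring

/-- Block means of normalized products of block sums. -/
theorem tendsto_blockAvg_sum_mul_sum (hn : Tendsto n l atTop)
    (hk : ∀ᶠ m in atTop, 1 ≤ k m ∧ k m < m) {lam : ℝ}
    (hlam : Tendsto (fun m : ℕ => (k m : ℝ) / m) atTop (𝓝 lam))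
    {f g : (i : ι) → Fin (n i) → ℝ} {c : ℝ}
    (hfg : Tendsto (fun i => (n i : ℝ)⁻¹ * ∑ j, f i j * g i j) l (𝓝 c))
    (hs : Tendsto (fun i => (n i : ℝ)⁻¹ * ((∑ j, f i j) * ∑ j, g i j)) l (𝓝 0)) :
    Tendsto (fun i => blockAvg (k (n i)) fun s =>
      (k (n i) : ℝ)⁻¹ * ((∑ j ∈ s, f i j) * ∑ j ∈ s, g i j)) l (𝓝 ((1 - lam) * c)) := by
  have hR : Tendsto (fun i => (n i : ℝ)) l atTop := tendsto_natCast_atTop_atTop.comp hn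
  have hinv : Tendsto (fun i => ((n i : ℝ))⁻¹) l (𝓝 0) := tendsto_inv_atTop_zero.comp hR
  have hkn := hlam.comp hn
  have hk' := hn.eventually hk
  -- The finite population correction `(n - k) / (n - 1)`, written in terms of `k / n` and `n⁻¹`;
  -- the next limit is that of `(k - 1) / (n - 1)`.
  have h1 : Tendsto (fun i => (1 - (k (n i) : ℝ) / n i) * (1 - (n i : ℝ)⁻¹)⁻¹) l
      (𝓝 (1 - lam)) := by
    simpa using (hkn.const_sub 1).mul ((hinv.const_sub 1).inv₀ (by simp))
  have h2 : Tendsto (fun i => ((k (n i) : ℝ) / n i - (n i : ℝ)⁻¹) * (1 - (n i : ℝ)⁻¹)⁻¹) l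
      (𝓝 lam) := by
    simpa using (hkn.sub hinv).mul ((hinv.const_sub 1).inv₀ (by simp))
  have h3 := (h1.mul hfg).add (h2.mul hs)
  rw [mul_zero, add_zero] at h3
  refine h3.congr' ?_
  filter_upwards [hk'] with i hi
  rw [blockAvg_const_mul, blockAvg_sum_mul_sum hi.1 hi.2]
  have e1 : (k (n i) : ℝ) ≠ 0 := by
    have := hi.1
    positivity
  have e2 : (1 : ℝ) < n i := by exact_mod_cast (by omega : 1 < n i)
  have e3 : (n i : ℝ) ≠ 0 := by positivity
  have e4 : (n i : ℝ) - 1 ≠ 0 := by linarith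
  have e5 : (1 - (n i : ℝ)⁻¹)⁻¹ = n i / (n i - 1) := by
    field_simp
  rw [e5]
  field_simp

/-- Boundedness of the block means of normalized squares of block sums. -/
theorem blockAvg_sq_sum_le {n k : ℕ} (hk : 1 ≤ k) (hn : k < n) (f : Fin n → ℝ) :
    blockAvg k (fun s => (k : ℝ)⁻¹ * (∑ j ∈ s, f j) ^ 2) ≤
      (n : ℝ)⁻¹ * ∑ j, f j * f j + (n : ℝ)⁻¹ * ((∑ j, f j) * ∑ j, f j) := by
  have e0 : (1 : ℝ) ≤ k := by exact_mod_cast hk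
  have e1 : (k : ℝ) < n := by exact_mod_cast hn
  have e3 : (0 : ℝ) < n := by linarith
  have e4 : (0 : ℝ) < (n : ℝ) - 1 := by linarith
  simp_rw [pow_two]
  rw [blockAvg_const_mul, blockAvg_sum_mul_sum hk hn, mul_add, ← mul_assoc, ← mul_assoc]
  have h1 : (k : ℝ)⁻¹ * (k * (n - k) / (n * (n - 1))) ≤ (n : ℝ)⁻¹ := by
    have : (k : ℝ)⁻¹ * (k * (n - k) / (n * (n - 1))) = (n : ℝ)⁻¹ * ((n - k) / (n - 1)) := by
      field_simp
    rw [this]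
    refine mul_le_of_le_one_right (by positivity) ((div_le_one e4).2 (by linarith))
  have h2 : (k : ℝ)⁻¹ * (k * (k - 1) / (n * (n - 1))) ≤ (n : ℝ)⁻¹ := by
    have : (k : ℝ)⁻¹ * (k * (k - 1) / (n * (n - 1))) = (n : ℝ)⁻¹ * ((k - 1) / (n - 1)) := by
      field_simp
    rw [this]
    refine mul_le_of_le_one_right (by positivity) ((div_le_one e4).2 (by linarith))
  gcongr
  · exact Finset.sum_nonneg fun j _ => mul_self_nonneg _
  · exact mul_self_nonneg _

/-- From `|f g| ≤ f² + g²`; only boundedness is wanted, so the sharp Cauchy–Schwarz constant is not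
needed. -/
theorem blockAvg_abs_mul_le {n k : ℕ} {f g : Finset (Fin n) → ℝ} {C D : ℝ}
    (hf : blockAvg k (fun s => (k : ℝ)⁻¹ * f s ^ 2) ≤ C)
    (hg : blockAvg k (fun s => (k : ℝ)⁻¹ * g s ^ 2) ≤ D) :
    blockAvg k (fun s => |(k : ℝ)⁻¹ * (f s * g s)|) ≤ C + D := by
  refine le_trans ?_ (add_le_add hf hg)
  rw [← blockAvg_add]
  refine blockAvg_mono fun s _ => ?_
  rw [abs_mul, abs_of_nonneg (by positivity : (0 : ℝ) ≤ (k : ℝ)⁻¹), ← mul_add]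
  refine mul_le_mul_of_nonneg_left ?_ (by positivity)
  rw [abs_mul]
  nlinarith [sq_nonneg (|f s| - |g s|), sq_abs (f s), sq_abs (g s), sq_nonneg (f s),
    sq_nonneg (g s)]

end BlockFilter

theorem abs_inv_mul_sum_le {n : ℕ} {f : Fin n → ℝ} {C : ℝ} (hC : 0 ≤ C) (h : ∀ j, |f j| ≤ C) :
    |(n : ℝ)⁻¹ * ∑ j, f j| ≤ C := by
  rw [abs_mul, abs_of_nonneg (by positivity : (0 : ℝ) ≤ (n : ℝ)⁻¹)]
  have h1 : |∑ j, f j| ≤ n * C := by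
    refine (Finset.abs_sum_le_sum_abs _ _).trans ?_
    simpa using Finset.sum_le_card_nsmul Finset.univ (fun j => |f j|) C fun j _ => h j
  rcases Nat.eq_zero_or_pos n with rfl | hn
  · simpa using hC
  · have : (0 : ℝ) < n := by exact_mod_cast hn
    rw [inv_mul_le_iff₀ this]
    exact h1

theorem tendsto_mul_of_abs_le {ι : Type*} {l : Filter ι} {f g : ι → ℝ} {C : ℝ}
    (hf : Tendsto f l (𝓝 0)) (hg : ∀ i, |g i| ≤ C) : Tendsto (fun i => f i * g i) l (𝓝 0) := by
  have hC : Tendsto (fun i => |f i| * C) l (𝓝 0) := by simpa using hf.abs.mul_const C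
  refine squeeze_zero_norm (fun i => ?_) hC
  rw [Real.norm_eq_abs, abs_mul]
  exact mul_le_mul_of_nonneg_left (hg i) (abs_nonneg _)

theorem tendsto_matrix_mulVec {ι : Type*} {l : Filter ι} {p : ℕ}
    {M : ι → Matrix (Fin p) (Fin p) ℝ} {M₀ : Matrix (Fin p) (Fin p) ℝ} {v : ι → Fin p → ℝ}
    {v₀ : Fin p → ℝ} (hM : Tendsto M l (𝓝 M₀)) (hv : Tendsto v l (𝓝 v₀)) :
    Tendsto (fun i => M i *ᵥ v i) l (𝓝 (M₀ *ᵥ v₀)) :=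
  tendsto_pi_nhds.2 fun a => tendsto_finsetSum Finset.univ fun b _ =>
    (tendsto_pi_nhds.1 (tendsto_pi_nhds.1 hM a) b).mul (tendsto_pi_nhds.1 hv b)

theorem inv_inv_smul {p : ℕ} {A : Matrix (Fin p) (Fin p) ℝ} (hA : A.PosDef) {c : ℝ}
    (hc : c ≠ 0) : (c⁻¹ • A)⁻¹ = c • A⁻¹ := by
  refine Matrix.inv_eq_left_inv ?_
  rw [Matrix.smul_mul, Matrix.mul_smul, smul_smul, mul_inv_cancel₀ hc, one_smul,
    Matrix.nonsing_inv_mul _ ((Matrix.isUnit_iff_isUnit_det _).1 hA.isUnit)]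

/-! ### Asymptotics of the scores -/

/-- The asymptotic regime: along the filter `l` of indices, with sample size `n`, noise `e` and
kernel matrix `Km`, the design, the block sizes and the empirical moments of the noise converge. -/
structure Regime {ι : Type*} {p : ℕ} (l : Filter ι) (n : ι → ℕ) (k : ℕ → ℕ)
    (X : (m : ℕ) → Matrix (Fin m) (Fin p) ℝ) (σ lam : ℝ) (Sig : Matrix (Fin p) (Fin p) ℝ)
    (e : (i : ι) → Fin (n i) → ℝ) (Km : ι → Matrix (Fin p) (Fin p) ℝ)
    (K₀ : Matrix (Fin p) (Fin p) ℝ) : Prop where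
  hn : Tendsto n l atTop
  hk : ∀ᶠ m in atTop, 1 ≤ k m ∧ k m < m
  hlam : Tendsto (fun m : ℕ => (k m : ℝ) / m) atTop (𝓝 lam)
  hlam1 : lam < 1
  hσ : 0 < σ
  hSig : Sig.PosDef
  hX : Tendsto (fun m : ℕ => (m : ℝ)⁻¹ • ((X m)ᵀ * X m)) atTop (𝓝 Sig)
  hbdd : ∃ c : ℝ, 0 ≤ c ∧ ∀ m i a, |X m i a| ≤ c
  hblock : Tendsto (fun j : Σ i, Finset (Fin (n i)) =>
    (n j.1 : ℝ)⁻¹ • ((rows (X (n j.1)) j.2)ᵀ * rows (X (n j.1)) j.2)) (blockFilter l n k)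
    (𝓝 (lam • Sig))
  hpd : ∀ᶠ i in l, (Km i).PosDef
  hpd₀ : K₀.PosDef
  hK : Tendsto Km l (𝓝 K₀)
  -- The noise enters only through these three families of weighted means; everything deduced from a
  -- `Regime` is deterministic.
  hmom1 : ∀ a, Tendsto (fun i => (n i : ℝ)⁻¹ * ∑ j, X (n i) j a * e i j) l (𝓝 0)
  hmom2 : ∀ a b, Tendsto (fun i => (n i : ℝ)⁻¹ *
    ∑ j, X (n i) j a * X (n i) j b * (e i j ^ 2 - σ ^ 2)) l (𝓝 0)
  hmom3 : ∀ a b c, Tendsto (fun i => (n i : ℝ)⁻¹ *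
    ∑ j, X (n i) j a * X (n i) j b * X (n i) j c * e i j) l (𝓝 0)

namespace Regime
variable {ι : Type*} {p : ℕ} {l : Filter ι} {n : ι → ℕ} {k : ℕ → ℕ}
    {X : (m : ℕ) → Matrix (Fin m) (Fin p) ℝ} {σ lam : ℝ} {Sig : Matrix (Fin p) (Fin p) ℝ}
    {e : (i : ι) → Fin (n i) → ℝ} {Km : ι → Matrix (Fin p) (Fin p) ℝ}
    {K₀ : Matrix (Fin p) (Fin p) ℝ} (β : Fin p → ℝ)
    (H : Regime l n k X σ lam Sig e Km K₀)
include H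

theorem inv_n : Tendsto (fun i => ((n i : ℝ))⁻¹) l (𝓝 0) :=
  tendsto_inv_atTop_zero.comp (tendsto_natCast_atTop_atTop.comp H.hn)

theorem moment : Tendsto (fun i => (n i : ℝ)⁻¹ • ((X (n i))ᵀ * X (n i))) l (𝓝 Sig) :=
  H.hX.comp H.hn

theorem moment_apply (a b : Fin p) :
    Tendsto (fun i => (n i : ℝ)⁻¹ * ∑ j, X (n i) j a * X (n i) j b) l (𝓝 (Sig a b)) := by
  have := tendsto_pi_nhds.1 (tendsto_pi_nhds.1 H.moment a) b
  simpa [Matrix.mul_apply] using this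

theorem K_inv : Tendsto (fun i => (Km i)⁻¹) l (𝓝 K₀⁻¹) := tendsto_matrix_inv H.hK H.hpd₀.isUnit

theorem gram_div : Tendsto (fun i => (n i : ℝ)⁻¹ • gram σ (X (n i)) (Km i)) l (𝓝 Sig) := by
  have h1 := H.inv_n.smul (H.K_inv.const_smul (σ ^ 2))
  rw [zero_smul] at h1
  have h2 := H.moment.add h1
  rw [add_zero] at h2
  exact h2.congr fun i => by rw [gram, smul_add]

/-- After division by `n` the normal equations have an invertible limit matrix `Σ`, and their right
side vanishes: the noise part by `hmom1`, the penalty because it is of order `n⁻¹`. -/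
theorem fitError_tendsto :
    Tendsto (fun i => fitError σ β (X (n i)) (e i) (Km i)) l (𝓝 0) := by
  have h1 : Tendsto (fun i => (n i : ℝ)⁻¹ • ((X (n i))ᵀ *ᵥ e i - σ ^ 2 • ((Km i)⁻¹ *ᵥ β))) l
      (𝓝 0) := by
    have h2 : Tendsto (fun i => (Km i)⁻¹ *ᵥ β) l (𝓝 (K₀⁻¹ *ᵥ β)) :=
      tendsto_matrix_mulVec H.K_inv tendsto_const_nhds
    have h3 := H.inv_n.smul (h2.const_smul (σ ^ 2))
    rw [zero_smul] at h3
    have h4 : Tendsto (fun i => (n i : ℝ)⁻¹ • ((X (n i))ᵀ *ᵥ e i)) l (𝓝 0) :=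
      tendsto_pi_nhds.2 fun a => H.hmom1 a
    have h5 := h4.sub h3
    rw [sub_zero] at h5
    exact h5.congr fun i => by rw [smul_sub]
  have h6 := tendsto_matrix_inv H.gram_div H.hSig.isUnit
  have h7 : Tendsto (fun i => ((n i : ℝ)⁻¹ • gram σ (X (n i)) (Km i))⁻¹ *ᵥ
      ((n i : ℝ)⁻¹ • ((X (n i))ᵀ *ᵥ e i - σ ^ 2 • ((Km i)⁻¹ *ᵥ β)))) l (𝓝 (Sig⁻¹ *ᵥ 0)) :=
    tendsto_matrix_mulVec h6 h1
  rw [Matrix.mulVec_zero] at h7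
  refine h7.congr' ?_
  filter_upwards [H.hn.eventually_ge_atTop 1, H.hpd] with i hi hp
  have hn0 : (n i : ℝ) ≠ 0 := by
    have : 0 < n i := hi
    positivity
  rw [inv_inv_smul (gram_posDef H.hσ (X (n i)) hp) hn0, fitError, Matrix.smul_mulVec,
    Matrix.mulVec_smul, smul_smul, mul_inv_cancel₀ hn0, one_smul]

theorem fitError_apply (a : Fin p) :
    Tendsto (fun i => fitError σ β (X (n i)) (e i) (Km i) a) l (𝓝 0) :=
  tendsto_pi_nhds.1 (H.fitError_tendsto β) a

theorem sum_score_tendsto (a : Fin p) :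
    Tendsto (fun i => ∑ j, score σ β (X (n i)) (e i) (Km i) j a) l
      (𝓝 (σ ^ 2 * (K₀⁻¹ *ᵥ β) a)) := by
  have h1 : Tendsto (fun i => (Km i)⁻¹ *ᵥ (β + fitError σ β (X (n i)) (e i) (Km i))) l
      (𝓝 (K₀⁻¹ *ᵥ (β + 0))) :=
    tendsto_matrix_mulVec H.K_inv ((H.fitError_tendsto β).const_add β)
  rw [add_zero] at h1
  refine ((tendsto_pi_nhds.1 h1 a).const_mul (σ ^ 2)).congr' ?_
  filter_upwards [H.hpd] with i hp
  rw [sum_score H.hσ β (X (n i)) (e i) hp]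

theorem mean_score_tendsto (a : Fin p) :
    Tendsto (fun i => (n i : ℝ)⁻¹ * ∑ j, score σ β (X (n i)) (e i) (Km i) j a) l (𝓝 0) := by
  simpa using H.inv_n.mul (H.sum_score_tendsto β a)

/-- Expand the product of the two residual factors. The squared noise contributes `σ² Σ`; each other
term carries at least one factor `fitError`, which tends to `0`, times a weighted mean that is
bounded or tends to `0`. -/
theorem mean_score_mul_score (a b : Fin p) :
    Tendsto (fun i => (n i : ℝ)⁻¹ * ∑ j, score σ β (X (n i)) (e i) (Km i) j a *
      score σ β (X (n i)) (e i) (Km i) j b) l (𝓝 (σ ^ 2 * Sig a b)) := by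
  obtain ⟨c, hc, hcX⟩ := H.hbdd
  have h1 := (H.hmom2 a b).add ((H.moment_apply a b).const_mul (σ ^ 2))
  have h2 : Tendsto (fun i => ∑ d, fitError σ β (X (n i)) (e i) (Km i) d * ((n i : ℝ)⁻¹ *
      ∑ j, X (n i) j a * X (n i) j b * X (n i) j d * e i j)) l (𝓝 0) := by
    simpa using tendsto_finsetSum Finset.univ
      fun d _ => (H.fitError_apply β d).mul (H.hmom3 a b d)
  have h3 : Tendsto (fun i => ∑ d, ∑ d', (fitError σ β (X (n i)) (e i) (Km i) d *
      fitError σ β (X (n i)) (e i) (Km i) d') * ((n i : ℝ)⁻¹ *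
      ∑ j, X (n i) j a * X (n i) j b * X (n i) j d * X (n i) j d')) l (𝓝 0) := by
    have : ∀ d d', Tendsto (fun i => (fitError σ β (X (n i)) (e i) (Km i) d *
        fitError σ β (X (n i)) (e i) (Km i) d') * ((n i : ℝ)⁻¹ *
        ∑ j, X (n i) j a * X (n i) j b * X (n i) j d * X (n i) j d')) l (𝓝 0) := by
      intro d d'
      refine tendsto_mul_of_abs_le (C := c * c * c * c)
        (by simpa using (H.fitError_apply β d).mul (H.fitError_apply β d')) fun i => ?_
      refine abs_inv_mul_sum_le (by positivity) fun j => ?_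
      simp only [abs_mul]
      gcongr <;> exact hcX _ _ _
    simpa using tendsto_finsetSum Finset.univ fun d _ =>
      tendsto_finsetSum Finset.univ fun d' _ => this d d'
  have h4 := (h1.sub (h2.const_mul 2)).add h3
  simp only [zero_add, mul_zero, sub_zero, add_zero] at h4
  refine h4.congr fun i => ?_
  set u := fitError σ β (X (n i)) (e i) (Km i) with hu
  have e1 : ∀ j, score σ β (X (n i)) (e i) (Km i) j a * score σ β (X (n i)) (e i) (Km i) j b =
      X (n i) j a * X (n i) j b * (e i j ^ 2 - σ ^ 2) + σ ^ 2 * (X (n i) j a * X (n i) j b) -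
      2 * (∑ d, u d * (X (n i) j a * X (n i) j b * X (n i) j d * e i j)) +
      ∑ d, ∑ d', (u d * u d') * (X (n i) j a * X (n i) j b * X (n i) j d * X (n i) j d') := by
    intro j
    have e2 : ∑ d, u d * (X (n i) j a * X (n i) j b * X (n i) j d * e i j) =
        X (n i) j a * X (n i) j b * e i j * (X (n i) j ⬝ᵥ u) := by
      simp only [dotProduct, Finset.mul_sum]
      exact Finset.sum_congr rfl fun d _ => by ring
    have e3 : ∑ d, ∑ d', (u d * u d') *
        (X (n i) j a * X (n i) j b * X (n i) j d * X (n i) j d') =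
        X (n i) j a * X (n i) j b * ((X (n i) j ⬝ᵥ u) * (X (n i) j ⬝ᵥ u)) := by
      simp only [dotProduct]
      rw [Finset.sum_mul_sum]
      simp only [Finset.mul_sum]
      exact Finset.sum_congr rfl fun d _ => Finset.sum_congr rfl fun d' _ => by ring
    rw [e2, e3]
    simp only [score, ← hu]
    ring
  simp_rw [e1]
  simp only [Finset.sum_add_distrib, Finset.sum_sub_distrib, mul_add, mul_sub, ← Finset.mul_sum]
  rw [Finset.sum_comm (s := (Finset.univ : Finset (Fin (n i))))]
  have e4 : ∑ j, ∑ d, ∑ d', (u d * u d') *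
      (X (n i) j a * X (n i) j b * X (n i) j d * X (n i) j d') = ∑ d, ∑ d', (u d * u d') *
      ∑ j, (X (n i) j a * X (n i) j b * X (n i) j d * X (n i) j d') := by
    rw [Finset.sum_comm]
    refine Finset.sum_congr rfl fun d _ => ?_
    rw [Finset.sum_comm]
    exact Finset.sum_congr rfl fun d' _ => (Finset.mul_sum _ _ _).symm
  rw [e4]
  simp only [Finset.mul_sum]
  congr 1
  · congr 1
    · congr 1
      exact Finset.sum_congr rfl fun j _ => by ring
    · exact Finset.sum_congr rfl fun d _ => Finset.sum_congr rfl fun j _ => by ring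
  · exact Finset.sum_congr rfl fun d _ => Finset.sum_congr rfl fun d' _ =>
      Finset.sum_congr rfl fun j _ => by ring

/-- The scores are asymptotically uncorrelated with products of two covariates. -/
theorem mean_centered_mul_score (a b d : Fin p) :
    Tendsto (fun i => (n i : ℝ)⁻¹ * ∑ j, (X (n i) j a * X (n i) j b -
      (n i : ℝ)⁻¹ * ∑ j, X (n i) j a * X (n i) j b) * score σ β (X (n i)) (e i) (Km i) j d) l
      (𝓝 0) := by
  obtain ⟨c, hc, hcX⟩ := H.hbdd
  have h2 : Tendsto (fun i => ∑ d', fitError σ β (X (n i)) (e i) (Km i) d' * ((n i : ℝ)⁻¹ *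
      ∑ j, X (n i) j a * X (n i) j b * X (n i) j d * X (n i) j d')) l (𝓝 0) := by
    have : ∀ d', Tendsto (fun i => fitError σ β (X (n i)) (e i) (Km i) d' * ((n i : ℝ)⁻¹ *
        ∑ j, X (n i) j a * X (n i) j b * X (n i) j d * X (n i) j d')) l (𝓝 0) := by
      intro d'
      refine tendsto_mul_of_abs_le (C := c * c * c * c) (H.fitError_apply β d') fun i => ?_
      refine abs_inv_mul_sum_le (by positivity) fun j => ?_
      simp only [abs_mul]
      gcongr <;> exact hcX _ _ _
    simpa using tendsto_finsetSum Finset.univ fun d' _ => this d'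
  -- Three contributions vanish: the noise part of the score, its `fitError` part, and the centering
  -- term, which is a convergent mean times the mean score.
  have h3 := ((H.hmom3 a b d).sub h2).sub ((H.moment_apply a b).mul (H.mean_score_tendsto β d))
  simp only [sub_zero, mul_zero] at h3
  refine h3.congr fun i => ?_
  set u := fitError σ β (X (n i)) (e i) (Km i) with hu
  simp only [sub_mul, Finset.sum_sub_distrib, mul_sub, ← Finset.mul_sum]
  congr 1
  · have e1 : ∀ j, X (n i) j a * X (n i) j b * score σ β (X (n i)) (e i) (Km i) j d =
        X (n i) j a * X (n i) j b * X (n i) j d * e i j -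
          ∑ d', u d' * (X (n i) j a * X (n i) j b * X (n i) j d * X (n i) j d') := by
      intro j
      have e2 : ∑ d', u d' * (X (n i) j a * X (n i) j b * X (n i) j d * X (n i) j d') =
          X (n i) j a * X (n i) j b * X (n i) j d * (X (n i) j ⬝ᵥ u) := by
        simp only [dotProduct, Finset.mul_sum]
        exact Finset.sum_congr rfl fun d _ => by ring
      rw [e2]
      simp only [score, ← hu]
      ring
    simp_rw [e1]
    rw [Finset.sum_sub_distrib, mul_sub]
    congr 1
    rw [Finset.sum_comm, Finset.mul_sum]
    refine Finset.sum_congr rfl fun d' _ => ?_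
    rw [← Finset.mul_sum]
    ring
  · ring

end Regime

/-! ### Limit of the averaged gradient -/

/-- The Gram matrix of a block, centered at its mean over all blocks of the same size. -/
noncomputable def centeredGram {n p : ℕ} (X : Matrix (Fin n) (Fin p) ℝ) (s : Finset (Fin n)) :
    Matrix (Fin p) (Fin p) ℝ :=
  (rows X s)ᵀ * rows X s - (s.card : ℝ) • ((n : ℝ)⁻¹ • (Xᵀ * X))

theorem centeredGram_apply {n p : ℕ} (X : Matrix (Fin n) (Fin p) ℝ) (s : Finset (Fin n))
    (a b : Fin p) : centeredGram X s a b =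
      ∑ j ∈ s, (X j a * X j b - (n : ℝ)⁻¹ * ∑ j, X j a * X j b) := by
  rw [Finset.sum_sub_distrib, Finset.sum_const, nsmul_eq_mul, centeredGram, Matrix.sub_apply,
    rows_gram_apply]
  simp [Matrix.mul_apply]

/-- The relation for `N` is inserted in the left factor, then in the right one. The expansion is
exact, with a leading term `b * q * b` free of `Γ` and both remainders linear in `c`. In the
application `b` and `q` do not depend on the block. -/
theorem sandwich_expand {p : ℕ} {N b q Γ : Matrix (Fin p) (Fin p) ℝ} {c : ℝ}
    (h : N = b + c • (b * Γ * N)) :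
    N * q * N = b * q * b + c • (b * Γ * (N * q * N)) + c • (b * q * b * Γ * N) := by
  have h1 : N * q * N = b * q * N + c • (b * Γ * (N * q * N)) := by
    calc N * q * N = (b + c • (b * Γ * N)) * q * N := congrArg (fun M => M * q * N) h
      _ = _ := by simp only [Matrix.add_mul, Matrix.smul_mul, Matrix.mul_assoc]
  have h2 : b * q * N = b * q * b + c • (b * q * b * Γ * N) := by
    calc b * q * N = b * q * (b + c • (b * Γ * N)) := congrArg (fun M => b * q * M) h
      _ = _ := by simp only [Matrix.mul_add, Matrix.mul_smul, Matrix.mul_assoc]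
  refine h1.trans ?_
  rw [h2, add_right_comm]

namespace Regime
variable {ι : Type*} {p : ℕ} {l : Filter ι} {n : ι → ℕ} {k : ℕ → ℕ}
    {X : (m : ℕ) → Matrix (Fin m) (Fin p) ℝ} {σ lam : ℝ} {Sig : Matrix (Fin p) (Fin p) ℝ}
    {e : (i : ι) → Fin (n i) → ℝ} {Km : ι → Matrix (Fin p) (Fin p) ℝ}
    {K₀ : Matrix (Fin p) (Fin p) ℝ} (β : Fin p → ℝ)
    (H : Regime l n k X σ lam Sig e Km K₀)
include H

theorem eventually_pos : ∀ᶠ i in l, 1 ≤ k (n i) ∧ k (n i) < n i := H.hn.eventually H.hk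

theorem score_mul_score (a b : Fin p) :
    Tendsto (fun i => blockAvg (k (n i)) fun s => (k (n i) : ℝ)⁻¹ *
      (blockScore σ β (X (n i)) (e i) (Km i) s a * blockScore σ β (X (n i)) (e i) (Km i) s b)) l
      (𝓝 ((1 - lam) * (σ ^ 2 * Sig a b))) := by
  refine tendsto_blockAvg_sum_mul_sum H.hn H.hk H.hlam (H.mean_score_mul_score β a b) ?_
  simpa using H.inv_n.mul ((H.sum_score_tendsto β a).mul (H.sum_score_tendsto β b))

theorem score_sq_bounded (a : Fin p) : ∃ C, ∀ᶠ i in l, blockAvg (k (n i)) (fun s =>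
    (k (n i) : ℝ)⁻¹ * blockScore σ β (X (n i)) (e i) (Km i) s a ^ 2) ≤ C := by
  refine ⟨(1 - lam) * (σ ^ 2 * Sig a a) + 1, ?_⟩
  simp_rw [pow_two (blockScore _ _ _ _ _ _ _)]
  exact ((H.score_mul_score β a a).eventually_lt_const (lt_add_one _)).mono fun i hi => hi.le

theorem score_mul_score_bounded (a b : Fin p) : ∃ C, ∀ᶠ i in l, blockAvg (k (n i)) (fun s =>
    |(k (n i) : ℝ)⁻¹ * (blockScore σ β (X (n i)) (e i) (Km i) s a *
      blockScore σ β (X (n i)) (e i) (Km i) s b)|) ≤ C := by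
  obtain ⟨C, hC⟩ := H.score_sq_bounded β a
  obtain ⟨D, hD⟩ := H.score_sq_bounded β b
  refine ⟨C + D, ?_⟩
  filter_upwards [hC, hD] with i h1 h2
  exact blockAvg_abs_mul_le h1 h2

theorem gram_mul_score (a b d : Fin p) :
    Tendsto (fun i => blockAvg (k (n i)) fun s => (k (n i) : ℝ)⁻¹ *
      (centeredGram (X (n i)) s a b * blockScore σ β (X (n i)) (e i) (Km i) s d)) l (𝓝 0) := by
  have h := tendsto_blockAvg_sum_mul_sum H.hn H.hk H.hlam (H.mean_centered_mul_score β a b d) ?_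
  · rw [mul_zero] at h
    simp_rw [centeredGram_apply]
    exact h
  · refine tendsto_const_nhds.congr' ?_
    filter_upwards [H.eventually_pos] with i hi
    have : (n i : ℝ) ≠ 0 := by
      have : 0 < n i := by omega
      positivity
    rw [Finset.sum_sub_distrib, Finset.sum_const, Finset.card_univ, Fintype.card_fin,
      nsmul_eq_mul, mul_inv_cancel_left₀ this, sub_self, zero_mul, mul_zero]

theorem gram_mul_score_bounded (a b d : Fin p) : ∃ C, ∀ᶠ i in l, blockAvg (k (n i)) (fun s =>
    |(k (n i) : ℝ)⁻¹ * (centeredGram (X (n i)) s a b *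
      blockScore σ β (X (n i)) (e i) (Km i) s d)|) ≤ C := by
  obtain ⟨c, hc, hcX⟩ := H.hbdd
  obtain ⟨D, hD⟩ := H.score_sq_bounded β d
  refine ⟨(c * c + c * c) * (c * c + c * c) + D, ?_⟩
  filter_upwards [hD, H.eventually_pos] with i h2 hi
  refine blockAvg_abs_mul_le ?_ h2
  simp_rw [centeredGram_apply]
  refine (blockAvg_sq_sum_le hi.1 hi.2 _).trans ?_
  have h0 : (n i : ℝ) ≠ 0 := by
    have : 0 < n i := by omega
    positivity
  have e1 : ∑ j, (X (n i) j a * X (n i) j b -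
      (n i : ℝ)⁻¹ * ∑ j, X (n i) j a * X (n i) j b) = 0 := by
    rw [Finset.sum_sub_distrib, Finset.sum_const, Finset.card_univ, Fintype.card_fin,
      nsmul_eq_mul, mul_inv_cancel_left₀ h0, sub_self]
  rw [e1, mul_zero, mul_zero, add_zero]
  have e2 : ∀ j, |X (n i) j a * X (n i) j b| ≤ c * c := fun j => by
    rw [abs_mul]
    gcongr <;> exact hcX _ _ _
  have e3 : ∀ j, |X (n i) j a * X (n i) j b -
      (n i : ℝ)⁻¹ * ∑ j, X (n i) j a * X (n i) j b| ≤ c * c + c * c := fun j =>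
    (abs_sub _ _).trans (add_le_add (e2 j) (abs_inv_mul_sum_le (by positivity) e2))
  refine (le_abs_self _).trans (abs_inv_mul_sum_le (by positivity) fun j => ?_)
  rw [abs_mul]
  gcongr <;> exact e3 j

theorem trainGram_tendsto : Tendsto (fun j : Σ i, Finset (Fin (n i)) =>
    (n j.1 : ℝ)⁻¹ • gram σ (rows (X (n j.1)) j.2ᶜ) (Km j.1)) (blockFilter l n k)
    (𝓝 ((1 - lam) • Sig)) := by
  have h1 := (H.gram_div.comp tendsto_fst_blockFilter).sub H.hblock
  rw [← one_smul ℝ Sig, smul_smul, mul_one, ← sub_smul] at h1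
  rw [← one_smul ℝ Sig, smul_smul, mul_one]
  refine h1.congr fun j => ?_
  rw [gram_rows_compl, smul_sub]
  rfl

theorem limit_posDef : ((1 - lam) • Sig).PosDef := H.hSig.smul (by linarith [H.hlam1])

theorem limit_inv : ((1 - lam) • Sig)⁻¹ = (1 - lam)⁻¹ • Sig⁻¹ := by
  have h : (1 - lam) ≠ 0 := by linarith [H.hlam1]
  simpa using inv_inv_smul H.hSig (inv_ne_zero h)

theorem trainGram_inv_tendsto : Tendsto (fun j : Σ i, Finset (Fin (n i)) =>
    ((n j.1 : ℝ)⁻¹ • gram σ (rows (X (n j.1)) j.2ᶜ) (Km j.1))⁻¹) (blockFilter l n k)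
    (𝓝 ((1 - lam)⁻¹ • Sig⁻¹)) := by
  rw [← H.limit_inv]
  exact tendsto_matrix_inv H.trainGram_tendsto H.limit_posDef.isUnit

theorem sandwich_tendsto : Tendsto (fun j : Σ i, Finset (Fin (n i)) =>
    ((n j.1 : ℝ)⁻¹ • gram σ (rows (X (n j.1)) j.2ᶜ) (Km j.1))⁻¹ *
      ((n j.1 : ℝ)⁻¹ • gram σ (X (n j.1)) (Km j.1)) *
      ((n j.1 : ℝ)⁻¹ • gram σ (rows (X (n j.1)) j.2ᶜ) (Km j.1))⁻¹) (blockFilter l n k)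
    (𝓝 (((1 - lam) ^ 2)⁻¹ • Sig⁻¹)) := by
  have h := (H.trainGram_inv_tendsto.mul (H.gram_div.comp tendsto_fst_blockFilter)).mul
    H.trainGram_inv_tendsto
  have e1 : (1 - lam)⁻¹ • Sig⁻¹ * Sig * ((1 - lam)⁻¹ • Sig⁻¹) = ((1 - lam) ^ 2)⁻¹ • Sig⁻¹ := by
    rw [Matrix.smul_mul, Matrix.nonsing_inv_mul _
      ((Matrix.isUnit_iff_isUnit_det _).1 H.hSig.isUnit), Matrix.smul_mul, Matrix.one_mul,
      smul_smul]
    congr 1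
    rw [pow_two, mul_inv]
  rw [e1] at h
  exact h

/-- The mean over all blocks of `k⁻¹ M₁ Γ M₂ E`, with `Γ` the centered Gram matrix and `E` the
score of the block, is negligible. -/
theorem mul_gram_mul_score {M₁ M₂ : (Σ i, Finset (Fin (n i))) → Matrix (Fin p) (Fin p) ℝ}
    {L₁ L₂ : Matrix (Fin p) (Fin p) ℝ} (h₁ : Tendsto M₁ (blockFilter l n k) (𝓝 L₁))
    (h₂ : Tendsto M₂ (blockFilter l n k) (𝓝 L₂)) (a : Fin p) :
    Tendsto (fun i => blockAvg (k (n i)) fun s => (k (n i) : ℝ)⁻¹ *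
      ((M₁ ⟨i, s⟩ * centeredGram (X (n i)) s * M₂ ⟨i, s⟩) *ᵥ
        blockScore σ β (X (n i)) (e i) (Km i) s) a) l (𝓝 0) := by
  have key : ∀ b c d, Tendsto (fun i => blockAvg (k (n i)) fun s =>
      (M₁ ⟨i, s⟩ a b * M₂ ⟨i, s⟩ c d) * ((k (n i) : ℝ)⁻¹ *
      (centeredGram (X (n i)) s b c * blockScore σ β (X (n i)) (e i) (Km i) s d))) l (𝓝 0) := by
    intro b c d
    obtain ⟨C, hC⟩ := H.gram_mul_score_bounded β b c d
    have := tendsto_blockAvg_mul ((tendsto_pi_nhds.1 (tendsto_pi_nhds.1 h₁ a) b).mul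
      (tendsto_pi_nhds.1 (tendsto_pi_nhds.1 h₂ c) d)) hC (H.gram_mul_score β b c d)
    rwa [mul_zero] at this
  have h3 := tendsto_finsetSum Finset.univ fun d _ => tendsto_finsetSum Finset.univ fun c _ =>
    tendsto_finsetSum Finset.univ fun b _ => key b c d
  simp only [Finset.sum_const_zero] at h3
  refine h3.congr fun i => ?_
  simp_rw [← blockAvg_sum]
  refine blockAvg_congr fun s _ => ?_
  simp only [Matrix.mulVec, dotProduct, Matrix.mul_apply, Finset.sum_mul, Finset.mul_sum]
  exact Finset.sum_congr rfl fun d _ => Finset.sum_congr rfl fun c _ =>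
    Finset.sum_congr rfl fun b _ => by ring

/-- The first order part of the gradient. -/
theorem score_avg (a : Fin p) :
    Tendsto (fun i => blockAvg (k (n i)) fun s => (n i / k (n i) : ℝ) *
      ((((n i : ℝ)⁻¹ • gram σ (rows (X (n i)) sᶜ) (Km i))⁻¹ *
      ((n i : ℝ)⁻¹ • gram σ (X (n i)) (Km i)) *
      ((n i : ℝ)⁻¹ • gram σ (rows (X (n i)) sᶜ) (Km i))⁻¹) *ᵥ
        blockScore σ β (X (n i)) (e i) (Km i) s) a) l
      (𝓝 (((σ ^ 2 / (1 - lam) ^ 2) • ((Sig⁻¹ * K₀⁻¹) *ᵥ β)) a)) := by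
  set q : ι → Matrix (Fin p) (Fin p) ℝ := fun i => (n i : ℝ)⁻¹ • gram σ (X (n i)) (Km i) with hq
  set N : (Σ i, Finset (Fin (n i))) → Matrix (Fin p) (Fin p) ℝ :=
    fun j => ((n j.1 : ℝ)⁻¹ • gram σ (rows (X (n j.1)) j.2ᶜ) (Km j.1))⁻¹ with hN
  -- The mean over all blocks of the scaled training Gram matrix. The scores are controlled only
  -- through means of `E Eᵀ / k`, so `(n/k) E` can be as large as `n / √k`; the sandwich `N q N` is
  -- therefore expanded around `ab⁻¹` instead of being replaced by its limit.
  set ab : ι → Matrix (Fin p) (Fin p) ℝ := fun i =>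
    q i - (k (n i) / n i : ℝ) • ((n i : ℝ)⁻¹ • ((X (n i))ᵀ * X (n i))) with hab
  have hab_t : Tendsto ab l (𝓝 ((1 - lam) • Sig)) := by
    have := H.gram_div.sub ((H.hlam.comp H.hn).smul H.moment)
    rwa [sub_smul, one_smul]
  have hb_t : Tendsto (fun i => (ab i)⁻¹) l (𝓝 ((1 - lam)⁻¹ • Sig⁻¹)) := by
    rw [← H.limit_inv]
    exact tendsto_matrix_inv hab_t H.limit_posDef.isUnit
  have hbqb_t : Tendsto (fun i => (ab i)⁻¹ * q i * (ab i)⁻¹) l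
      (𝓝 (((1 - lam) ^ 2)⁻¹ • Sig⁻¹)) := by
    have h := (hb_t.mul H.gram_div).mul hb_t
    have e1 : (1 - lam)⁻¹ • Sig⁻¹ * Sig * ((1 - lam)⁻¹ • Sig⁻¹) =
        ((1 - lam) ^ 2)⁻¹ • Sig⁻¹ := by
      rw [Matrix.smul_mul, Matrix.nonsing_inv_mul _
        ((Matrix.isUnit_iff_isUnit_det _).1 H.hSig.isUnit), Matrix.smul_mul, Matrix.one_mul,
        smul_smul]
      congr 1
      rw [pow_two, mul_inv]
    rwa [e1] at h
  have hab_u : ∀ᶠ i in l, IsUnit (ab i).det := by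
    have h1 : Tendsto (fun i => (ab i).det) l (𝓝 ((1 - lam) • Sig).det) :=
      ((Continuous.matrix_det continuous_id).tendsto _).comp hab_t
    have h2 := ((Matrix.isUnit_iff_isUnit_det _).1 H.limit_posDef.isUnit).ne_zero
    exact (h1.eventually_ne h2).mono fun i hi => isUnit_iff_ne_zero.2 hi
  -- The two remainders of `sandwich_expand`: their factor `n⁻¹ Γ` times `n / k` leaves `k⁻¹ Γ E`,
  -- whose weighted block means vanish.
  have t1 := H.mul_gram_mul_score β (hb_t.comp tendsto_fst_blockFilter) H.sandwich_tendsto a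
  have t2 := H.mul_gram_mul_score β (hbqb_t.comp tendsto_fst_blockFilter)
    H.trainGram_inv_tendsto a
  have t0 : Tendsto (fun i => ∑ c, ((ab i)⁻¹ * q i * (ab i)⁻¹) a c *
      ∑ j, score σ β (X (n i)) (e i) (Km i) j c) l
      (𝓝 (∑ c, (((1 - lam) ^ 2)⁻¹ • Sig⁻¹) a c * (σ ^ 2 * (K₀⁻¹ *ᵥ β) c))) :=
    tendsto_finsetSum Finset.univ fun c _ =>
      (tendsto_pi_nhds.1 (tendsto_pi_nhds.1 hbqb_t a) c).mul (H.sum_score_tendsto β c)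
  have t := (t0.add t1).add t2
  have elim : ∑ c, (((1 - lam) ^ 2)⁻¹ • Sig⁻¹) a c * (σ ^ 2 * (K₀⁻¹ *ᵥ β) c) + 0 + 0 =
      ((σ ^ 2 / (1 - lam) ^ 2) • ((Sig⁻¹ * K₀⁻¹) *ᵥ β)) a := by
    rw [← Matrix.mulVec_mulVec, Pi.smul_apply, smul_eq_mul, Matrix.mulVec, dotProduct,
      Finset.mul_sum, add_zero, add_zero]
    refine Finset.sum_congr rfl fun c _ => ?_
    rw [Matrix.smul_apply, smul_eq_mul]
    ring
  rw [elim] at t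
  refine t.congr' ?_
  filter_upwards [hab_u, H.eventually_pos, H.hpd] with i hui hi hpd
  have hn0 : (n i : ℝ) ≠ 0 := by
    have : 0 < n i := by omega
    positivity
  have hk0 : (k (n i) : ℝ) ≠ 0 := by
    have : 0 < k (n i) := by omega
    positivity
  -- The coefficients do not depend on the block, and the block mean of `(n/k) E` is exactly the
  -- total score.
  have e0 : ∑ c, ((ab i)⁻¹ * q i * (ab i)⁻¹) a c * ∑ j, score σ β (X (n i)) (e i) (Km i) j c =
      blockAvg (k (n i)) fun s => (n i / k (n i) : ℝ) * (((ab i)⁻¹ * q i * (ab i)⁻¹) *ᵥ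
        blockScore σ β (X (n i)) (e i) (Km i) s) a := by
    simp only [Matrix.mulVec, dotProduct, blockScore]
    rw [blockAvg_const_mul, blockAvg_sum, Finset.mul_sum]
    refine Finset.sum_congr rfl fun c _ => ?_
    rw [blockAvg_const_mul, blockAvg_sum_mem hi.1 hi.2.le]
    field_simp
  rw [e0, ← blockAvg_add, ← blockAvg_add]
  refine blockAvg_congr fun s hs => ?_
  set E := blockScore σ β (X (n i)) (e i) (Km i) s
  set Γ := centeredGram (X (n i)) s with hΓ
  set b := (ab i)⁻¹ with hb
  have hA := (gram_posDef H.hσ (rows (X (n i)) sᶜ) hpd)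
  have hN1 : N ⟨i, s⟩ * ((n i : ℝ)⁻¹ • gram σ (rows (X (n i)) sᶜ) (Km i)) = 1 := by
    simp only [hN]
    rw [inv_inv_smul hA hn0, Matrix.smul_mul, Matrix.mul_smul, smul_smul, mul_inv_cancel₀ hn0,
      one_smul, Matrix.nonsing_inv_mul _ ((Matrix.isUnit_iff_isUnit_det _).1 hA.isUnit)]
  have hN2 : ((n i : ℝ)⁻¹ • gram σ (rows (X (n i)) sᶜ) (Km i)) * N ⟨i, s⟩ = 1 :=
    mul_eq_one_comm.1 hN1
  have hb1 : b * ab i = 1 := Matrix.nonsing_inv_mul _ hui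
  have hsplit : ((n i : ℝ)⁻¹ • gram σ (rows (X (n i)) sᶜ) (Km i)) = ab i - (n i : ℝ)⁻¹ • Γ := by
    rw [gram_rows_compl, hΓ, centeredGram, hs]
    simp only [hab, hq, smul_sub, smul_smul]
    have : (n i : ℝ)⁻¹ * (k (n i) * (n i : ℝ)⁻¹) = k (n i) / n i * (n i : ℝ)⁻¹ := by
      field_simp
    rw [this]
    abel
  -- `N` is the inverse of `ab - n⁻¹ Γ` and `b` that of `ab`; this is the resolvent identity.
  have hdiff : N ⟨i, s⟩ = b + (n i : ℝ)⁻¹ • (b * Γ * N ⟨i, s⟩) := by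
    have h1 : b * (ab i - (n i : ℝ)⁻¹ • Γ) * N ⟨i, s⟩ = b := by
      rw [← hsplit, Matrix.mul_assoc, hN2, Matrix.mul_one]
    rw [Matrix.mul_sub, hb1, Matrix.sub_mul, Matrix.one_mul, Matrix.mul_smul,
      Matrix.smul_mul] at h1
    exact sub_eq_iff_eq_add.1 h1
  have hB := sandwich_expand (q := q i) hdiff
  change _ = (n i / k (n i) : ℝ) * ((N ⟨i, s⟩ * q i * N ⟨i, s⟩) *ᵥ E) a
  conv_rhs => rw [hB]
  simp only [Matrix.add_mulVec, Matrix.smul_mulVec, Pi.add_apply, Pi.smul_apply, smul_eq_mul]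
  change _ + (k (n i) : ℝ)⁻¹ * ((b * Γ * (N ⟨i, s⟩ * q i * N ⟨i, s⟩)) *ᵥ E) a +
    (k (n i) : ℝ)⁻¹ * (((b * q i * b) * Γ * N ⟨i, s⟩) *ᵥ E) a = _
  field_simp

/-- The second order part of the gradient. -/
theorem score_outer_avg (a d : Fin p) :
    Tendsto (fun i => blockAvg (k (n i)) fun s =>
      ((((n i : ℝ)⁻¹ • gram σ (rows (X (n i)) sᶜ) (Km i))⁻¹ *
      ((n i : ℝ)⁻¹ • gram σ (X (n i)) (Km i)) *
      ((n i : ℝ)⁻¹ • gram σ (rows (X (n i)) sᶜ) (Km i))⁻¹) *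
      ((k (n i) : ℝ)⁻¹ • vecMulVec (blockScore σ β (X (n i)) (e i) (Km i) s)
        (blockScore σ β (X (n i)) (e i) (Km i) s)) *
      ((n i : ℝ)⁻¹ • gram σ (rows (X (n i)) sᶜ) (Km i))⁻¹) a d) l
      (𝓝 (((σ ^ 2 / (1 - lam) ^ 2) • Sig⁻¹) a d)) := by
  have key : ∀ b c, Tendsto _ l _ := fun b c => by
    obtain ⟨C, hC⟩ := H.score_mul_score_bounded β b c
    exact tendsto_blockAvg_mul ((tendsto_pi_nhds.1 (tendsto_pi_nhds.1 H.sandwich_tendsto a) b).mul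
      (tendsto_pi_nhds.1 (tendsto_pi_nhds.1 H.trainGram_inv_tendsto c) d)) hC
      (H.score_mul_score β b c)
  have h3 := tendsto_finsetSum Finset.univ fun c _ =>
    tendsto_finsetSum Finset.univ fun b _ => key b c
  -- The powers of `1 - lam`: exponent `-2` from the sandwich, `-1` from `N`, and `+1` from the
  -- finite population correction.
  have elim : ∑ c, ∑ b, ((((1 - lam) ^ 2)⁻¹ • Sig⁻¹) a b * ((1 - lam)⁻¹ • Sig⁻¹) c d) *
      ((1 - lam) * (σ ^ 2 * Sig b c)) = ((σ ^ 2 / (1 - lam) ^ 2) • Sig⁻¹) a d := by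
    have h : (1 - lam) ≠ 0 := by linarith [H.hlam1]
    have : (σ ^ 2 / (1 - lam) ^ 2) • Sig⁻¹ =
        (σ ^ 2 / (1 - lam) ^ 2) • (Sig⁻¹ * Sig * Sig⁻¹) := by
      rw [Matrix.nonsing_inv_mul _ ((Matrix.isUnit_iff_isUnit_det _).1 H.hSig.isUnit),
        Matrix.one_mul]
    rw [this]
    simp only [Matrix.smul_apply, Matrix.mul_apply, smul_eq_mul, Finset.mul_sum, Finset.sum_mul]
    refine Finset.sum_congr rfl fun c _ => Finset.sum_congr rfl fun b _ => ?_
    field_simp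
  rw [elim] at h3
  refine h3.congr fun i => ?_
  simp_rw [← blockAvg_sum]
  refine blockAvg_congr fun s _ => ?_
  set N := ((n i : ℝ)⁻¹ • gram σ (rows (X (n i)) sᶜ) (Km i))⁻¹
  set B := N * ((n i : ℝ)⁻¹ • gram σ (X (n i)) (Km i)) * N
  rw [Matrix.mul_apply]
  simp only [Matrix.mul_apply (M := B), Matrix.smul_apply, vecMulVec_apply, smul_eq_mul,
    Finset.sum_mul]
  refine Finset.sum_congr rfl fun c _ => Finset.sum_congr rfl fun b _ => ?_
  ring

/-- Convergence of `n²` times the gradient of the cross validation criterion. -/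
theorem sq_mul_lkocvGrad (a b : Fin p) :
    Tendsto (fun i => (n i : ℝ) ^ 2 *
      lkocvGrad σ (k (n i)) (X (n i)) (X (n i) *ᵥ β + e i) (Km i) a b) l
      (𝓝 (((2 * σ ^ 4 / (1 - lam) ^ 2) •
        (K₀⁻¹ * Sig⁻¹ * K₀⁻¹ * (K₀ - vecMulVec β β) * K₀⁻¹)) a b)) := by
  set D : (i : ι) → Finset (Fin (n i)) → Matrix (Fin p) (Fin p) ℝ := fun i s =>
    vecMulVec ((n i / k (n i) : ℝ) • ((((n i : ℝ)⁻¹ • gram σ (rows (X (n i)) sᶜ) (Km i))⁻¹ *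
      ((n i : ℝ)⁻¹ • gram σ (X (n i)) (Km i)) *
      ((n i : ℝ)⁻¹ • gram σ (rows (X (n i)) sᶜ) (Km i))⁻¹) *ᵥ
        blockScore σ β (X (n i)) (e i) (Km i) s)) (β + fitError σ β (X (n i)) (e i) (Km i)) -
      ((((n i : ℝ)⁻¹ • gram σ (rows (X (n i)) sᶜ) (Km i))⁻¹ *
      ((n i : ℝ)⁻¹ • gram σ (X (n i)) (Km i)) *
      ((n i : ℝ)⁻¹ • gram σ (rows (X (n i)) sᶜ) (Km i))⁻¹) *
      ((k (n i) : ℝ)⁻¹ • vecMulVec (blockScore σ β (X (n i)) (e i) (Km i) s)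
        (blockScore σ β (X (n i)) (e i) (Km i) s)) *
      ((n i : ℝ)⁻¹ • gram σ (rows (X (n i)) sᶜ) (Km i))⁻¹) with hD
  set L := (σ ^ 2 / (1 - lam) ^ 2) • (vecMulVec ((Sig⁻¹ * K₀⁻¹) *ᵥ β) β - Sig⁻¹) with hL
  have h1 : Tendsto (fun i => (Matrix.of fun c d => blockAvg (k (n i)) fun s => D i s c d :
      Matrix (Fin p) (Fin p) ℝ)) l (𝓝 L) := by
    refine tendsto_pi_nhds.2 fun c => tendsto_pi_nhds.2 fun d => ?_
    have t1 := (H.score_avg β c).mul (((H.fitError_apply β d)).const_add (β d))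
    have t2 := t1.sub (H.score_outer_avg β c d)
    have elim : ((σ ^ 2 / (1 - lam) ^ 2) • ((Sig⁻¹ * K₀⁻¹) *ᵥ β)) c * (β d + 0) -
        ((σ ^ 2 / (1 - lam) ^ 2) • Sig⁻¹) c d = L c d := by
      simp only [hL, Pi.smul_apply, Matrix.smul_apply, Matrix.sub_apply, vecMulVec_apply,
        smul_eq_mul]
      ring
    rw [elim] at t2
    refine t2.congr fun i => ?_
    rw [mul_comm, ← blockAvg_const_mul, ← blockAvg_sub, Matrix.of_apply]
    refine blockAvg_congr fun s _ => ?_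
    simp only [hD, Matrix.sub_apply, vecMulVec_apply, Pi.smul_apply, Pi.add_apply, smul_eq_mul]
    ring
  have h2 := ((H.K_inv.mul h1).mul H.K_inv).const_smul (-(2 * σ ^ 2))
  have h3 := tendsto_pi_nhds.1 (tendsto_pi_nhds.1 h2 a) b
  have elim : -(2 * σ ^ 2) • (K₀⁻¹ * L * K₀⁻¹) = (2 * σ ^ 4 / (1 - lam) ^ 2) •
        (K₀⁻¹ * Sig⁻¹ * K₀⁻¹ * (K₀ - vecMulVec β β) * K₀⁻¹) := by
    have hu := (Matrix.isUnit_iff_isUnit_det _).1 H.hpd₀.isUnit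
    -- The factor `K₀⁻¹ (K₀ - ββᵀ)` is `1 - K₀⁻¹ββᵀ`, which separates the quadratic and the linear
    -- contribution.
    have e1 : K₀⁻¹ * Sig⁻¹ * K₀⁻¹ * (K₀ - vecMulVec β β) * K₀⁻¹ =
        -(K₀⁻¹ * (vecMulVec ((Sig⁻¹ * K₀⁻¹) *ᵥ β) β - Sig⁻¹) * K₀⁻¹) := by
      rw [← Matrix.mul_vecMulVec, Matrix.mul_sub, Matrix.mul_assoc _ _ K₀, Matrix.nonsing_inv_mul _ hu,
        Matrix.mul_one, Matrix.mul_sub, ← Matrix.neg_mul, neg_sub]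
      simp only [Matrix.mul_assoc]
    rw [e1, hL, Matrix.mul_smul, Matrix.smul_mul, smul_smul, smul_neg, ← neg_smul]
    congr 1
    ring
  rw [elim] at h3
  refine h3.congr' ?_
  filter_upwards [H.eventually_pos, H.hpd] with i hi hpd
  have hn0 : n i ≠ 0 := by omega
  have hn0' : (n i : ℝ) ≠ 0 := by exact_mod_cast hn0
  rw [lkocvGrad_apply, ← blockAvg_const_mul, Matrix.smul_apply, smul_eq_mul]
  rw [← blockAvg_mul_mul, ← blockAvg_const_mul]
  refine blockAvg_congr fun s hs => ?_
  have h4 := sq_smul_apeGrad H.hσ β (X (n i)) (e i) hpd s hn0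
    (inv_inv_smul (gram_posDef H.hσ (rows (X (n i)) sᶜ) hpd) hn0') rfl
  have h5 := congrFun (congrFun h4 a) b
  rw [Matrix.smul_apply, Matrix.smul_apply, smul_eq_mul, smul_eq_mul, hs] at h5
  exact h5.symm

end Regime

/-! ### Convergence in probability and weighted means of the noise -/

section Probability
variable {Ω : Type*} [MeasurableSpace Ω] {P : Measure Ω}

/-- The filter on `ℕ × Ω` along which convergence is convergence in probability. -/
def probFilter (P : Measure Ω) : Filter (ℕ × Ω) where
  -- The measure is monotone and subadditive on all sets, so the filter axioms need no
  -- measurability.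
  sets := {S | Tendsto (fun n => P {ω | (n, ω) ∉ S}) atTop (𝓝 0)}
  univ_sets := by simp
  sets_of_superset := fun {S T} hS hST =>
    tendsto_of_tendsto_of_tendsto_of_le_of_le tendsto_const_nhds hS (fun _ => zero_le)
      fun n => measure_mono fun ω hω h => hω (hST h)
  inter_sets := fun {S T} hS hT => by
    have h : Tendsto (fun n => P {ω | (n, ω) ∉ S} + P {ω | (n, ω) ∉ T}) atTop (𝓝 0) := by
      simpa using Tendsto.add hS hT
    refine tendsto_of_tendsto_of_tendsto_of_le_of_le tendsto_const_nhds h (fun _ => zero_le)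
      fun n => ?_
    refine (measure_mono fun ω hω => ?_).trans (measure_union_le _ _)
    by_contra hc
    simp only [Set.mem_union, Set.mem_ofPred_eq, not_or, not_not] at hc
    exact hω hc

theorem eventually_probFilter {Q : ℕ × Ω → Prop} :
    (∀ᶠ x in probFilter P, Q x) ↔ Tendsto (fun n => P {ω | ¬ Q (n, ω)}) atTop (𝓝 0) := Iff.rfl

theorem tendsto_fst_probFilter : Tendsto Prod.fst (probFilter P) atTop := by
  intro S hS
  refine eventually_probFilter.2 (tendsto_const_nhds.congr' ?_)
  filter_upwards [hS] with n hn
  simp [hn]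

theorem tendstoInMeasure_of_tendsto_probFilter {f : ℕ → Ω → ℝ} {c : ℝ}
    (h : Tendsto (fun x : ℕ × Ω => f x.1 x.2) (probFilter P) (𝓝 c)) :
    TendstoInMeasure P f atTop fun _ => c := by
  intro δ hδ
  have := eventually_probFilter.1 (EMetric.tendsto_nhds.1 h δ hδ)
  simpa using this

/-- Chebyshev's inequality: by pairwise independence the sum has variance at most `n C² V`, so the
mean has variance of order `n⁻¹`. The weights may change with `n`, as the design does. -/
theorem tendsto_weighted_mean [IsProbabilityMeasure P] {ξ : ℕ → Ω → ℝ}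
    (hind : Pairwise fun i j => IndepFun (ξ i) (ξ j) P) (hL : ∀ i, MemLp (ξ i) 2 P)
    (hmean : ∀ i, ∫ ω, ξ i ω ∂P = 0) {V : ℝ} (hV : ∀ i, variance (ξ i) P ≤ V)
    {w : (n : ℕ) → Fin n → ℝ} {C : ℝ} (hw : ∀ n j, |w n j| ≤ C) :
    Tendsto (fun x : ℕ × Ω => (x.1 : ℝ)⁻¹ * ∑ j, w x.1 j * ξ j x.2) (probFilter P) (𝓝 0) := by
  have hV0 : 0 ≤ V := (variance_nonneg _ _).trans (hV 0)
  have hint : ∀ i, Integrable (ξ i) P := fun i => (hL i).integrable (by norm_num)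
  have hvar : ∀ n : ℕ, variance (∑ j : Fin n, fun ω => w n j * ξ j ω) P ≤ n * (C ^ 2 * V) := by
    intro n
    rw [IndepFun.variance_sum fun (j : Fin n) _ => (hL j).const_mul (w n j)]
    · have : ∀ j ∈ (Finset.univ : Finset (Fin n)),
          variance (fun ω => w n j * ξ j ω) P ≤ C ^ 2 * V := by
        intro j _
        rw [variance_const_mul]
        have h1 : w n j ^ 2 ≤ C ^ 2 := sq_le_sq' (neg_le_of_abs_le (hw n j))
          ((le_abs_self _).trans (hw n j))
        exact mul_le_mul h1 (hV j) (variance_nonneg _ _) (sq_nonneg _)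
      simpa using Finset.sum_le_card_nsmul _ _ _ this
    · intro i _ j _ hij
      exact (hind (fun h => hij (Fin.ext h))).comp (measurable_const_mul (w n i))
        (measurable_const_mul (w n j))
  have hmean' : ∀ n : ℕ, ∫ ω, (∑ j : Fin n, fun ω => w n j * ξ j ω) ω ∂P = 0 := by
    intro n
    simp only [Finset.sum_apply]
    rw [integral_finsetSum _ fun (j : Fin n) _ => (hint j).const_mul (w n j)]
    simp [integral_const_mul, hmean]
  rw [Metric.tendsto_nhds]
  intro δ hδ
  refine eventually_probFilter.2 ?_
  have hlim : Tendsto (fun n : ℕ => ENNReal.ofReal ((C ^ 2 * V / δ ^ 2) * (n : ℝ)⁻¹)) atTop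
      (𝓝 0) := by
    have : Tendsto (fun n : ℕ => (C ^ 2 * V / δ ^ 2) * (n : ℝ)⁻¹) atTop (𝓝 0) := by
      simpa using (tendsto_inv_atTop_zero.comp tendsto_natCast_atTop_atTop).const_mul
        (C ^ 2 * V / δ ^ 2)
    simpa using ENNReal.tendsto_ofReal this
  refine tendsto_of_tendsto_of_tendsto_of_le_of_le' tendsto_const_nhds hlim
    (Eventually.of_forall fun _ => zero_le) ?_
  filter_upwards [eventually_ge_atTop 1] with n hn
  have hn0 : (0 : ℝ) < n := by exact_mod_cast hn
  have hch := meas_ge_le_variance_div_sq (μ := P)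
    (memLp_finsetSum' Finset.univ fun (j : Fin n) _ => (hL j).const_mul (w n j))
    (c := n * δ) (by positivity)
  rw [hmean'] at hch
  refine ((measure_mono fun ω hω => ?_).trans hch).trans (ENNReal.ofReal_le_ofReal ?_)
  · simp only [Set.mem_ofPred_eq, not_lt, Real.dist_eq, sub_zero, abs_mul, abs_inv,
      Nat.abs_cast] at hω
    simp only [Set.mem_ofPred_eq, sub_zero, Finset.sum_apply]
    rwa [inv_mul_eq_div, le_div_iff₀ hn0, mul_comm] at hω
  · calc _ ≤ n * (C ^ 2 * V) / (n * δ) ^ 2 := by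
          gcongr
          exact hvar n
      _ = _ := by field_simp

/-- In the i.i.d. noise model with fourth moments, the weighted means of the noise, and of its
centered squares, vanish in probability. -/
theorem noise_means [IsProbabilityMeasure P] {σ : ℝ} {ε : ℕ → Ω → ℝ}
    (hindep : iIndepFun ε P) (hident : ∀ i, IdentDistrib (ε i) (ε 0) P P)
    (hmean : ∀ i, ∫ ω, ε i ω ∂P = 0) (hvar : ∀ i, variance (ε i) P = σ ^ 2)
    (hmom : ∀ i, Integrable (fun ω => |ε i ω| ^ 4) P)
    {w : (n : ℕ) → Fin n → ℝ} {C : ℝ} (hw : ∀ n j, |w n j| ≤ C) :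
    Tendsto (fun x : ℕ × Ω => (x.1 : ℝ)⁻¹ * ∑ j, w x.1 j * ε j x.2) (probFilter P) (𝓝 0) ∧
    Tendsto (fun x : ℕ × Ω => (x.1 : ℝ)⁻¹ * ∑ j, w x.1 j * (ε j x.2 ^ 2 - σ ^ 2))
      (probFilter P) (𝓝 0) := by
  have hm : ∀ i, AEMeasurable (ε i) P := fun i => (hident i).aemeasurable_fst
  have hsq : ∀ i, MemLp (fun ω => ε i ω ^ 2) 2 P := fun i => by
    -- The fourth moment makes the squared noise square integrable, as the variance bound for its
    -- weighted means requires.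
    refine (memLp_two_iff_integrable_sq ((hm i).pow_const 2).aestronglyMeasurable).2 ?_
    refine (hmom i).congr (Eventually.of_forall fun ω => ?_)
    simp only [← pow_mul]
    exact Even.pow_abs (by decide) _
  have hL : ∀ i, MemLp (ε i) 2 P := fun i =>
    (memLp_two_iff_integrable_sq (hm i).aestronglyMeasurable).2
      ((hsq i).integrable (by norm_num))
  have hEsq : ∀ i, ∫ ω, ε i ω ^ 2 ∂P = σ ^ 2 := fun i => by
    rw [← hvar i, variance_of_integral_eq_zero (hm i) (hmean i)]
  refine ⟨tendsto_weighted_mean (fun i j hij => hindep.indepFun hij) hL hmean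
    (fun i => (hvar i).le) hw, tendsto_weighted_mean (ξ := fun i ω => ε i ω ^ 2 - σ ^ 2)
    (V := variance (fun ω => ε 0 ω ^ 2 - σ ^ 2) P) (fun i j hij => ?_) (fun i => ?_) (fun i => ?_)
    (fun i => ?_) hw⟩
  · have hφ : Measurable fun x : ℝ => x ^ 2 - σ ^ 2 := by fun_prop
    exact (hindep.indepFun hij).comp hφ hφ
  · exact (hsq i).sub (memLp_const _)
  · rw [integral_sub ((hsq i).integrable (by norm_num)) (integrable_const _), hEsq]
    simp
  · have hφ : Measurable fun x : ℝ => x ^ 2 - σ ^ 2 := by fun_prop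
    exact ((hident i).comp hφ).variance_eq.le

end Probability

/-! ### Uniform convergence of block Gram matrices -/

section Blocks
variable {p : ℕ} {X : (n : ℕ) → Matrix (Fin n) (Fin p) ℝ} {k : ℕ → ℕ}
  {Sig : Matrix (Fin p) (Fin p) ℝ}

theorem tendsto_rows_gram_comp {ι : Type*} {l : Filter ι} {n : ι → ℕ} (hn : Tendsto n l atTop)
    {L : Matrix (Fin p) (Fin p) ℝ}
    (h : Tendsto (fun j : Σ m : ℕ, Finset (Fin m) =>
      (j.1 : ℝ)⁻¹ • ((rows (X j.1) j.2)ᵀ * rows (X j.1) j.2))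
      (blockFilter atTop (fun m => m) k) (𝓝 L)) :
    Tendsto (fun j : Σ i, Finset (Fin (n i)) =>
      (n j.1 : ℝ)⁻¹ • ((rows (X (n j.1)) j.2)ᵀ * rows (X (n j.1)) j.2))
      (blockFilter l n k) (𝓝 L) := by
  refine tendsto_def.2 fun U hU => ?_
  have h1 := eventually_blockFilter.1 (h.eventually hU)
  exact eventually_blockFilter.2 (hn.eventually h1)

/-- If the blocks are a vanishing fraction of the data, then their Gram matrices are uniformly
negligible. -/
theorem tendsto_rows_gram_of_zero {c : ℝ} (hc : 0 ≤ c) (hbdd : ∀ m i a, |X m i a| ≤ c)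
    (hlam : Tendsto (fun n : ℕ => (k n : ℝ) / n) atTop (𝓝 0)) :
    Tendsto (fun j : Σ m : ℕ, Finset (Fin m) =>
      (j.1 : ℝ)⁻¹ • ((rows (X j.1) j.2)ᵀ * rows (X j.1) j.2))
      (blockFilter atTop (fun m => m) k) (𝓝 ((0 : ℝ) • Sig)) := by
  rw [zero_smul]
  refine tendsto_pi_nhds.2 fun a => tendsto_pi_nhds.2 fun b => ?_
  have h1 : Tendsto (fun j : Σ m : ℕ, Finset (Fin m) => (k j.1 : ℝ) / j.1 * (c * c))
      (blockFilter atTop (fun m => m) k) (𝓝 0) := by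
    simpa using (hlam.comp tendsto_fst_blockFilter).mul_const (c * c)
  refine squeeze_zero_norm' ?_ h1
  refine eventually_blockFilter.2 (Eventually.of_forall fun m s hs => ?_)
  rw [Matrix.smul_apply, rows_gram_apply, smul_eq_mul, Real.norm_eq_abs, abs_mul, abs_inv,
    Nat.abs_cast, div_eq_inv_mul, mul_assoc]
  refine mul_le_mul_of_nonneg_left ((Finset.abs_sum_le_sum_abs _ _).trans ?_) (by positivity)
  have := Finset.sum_le_card_nsmul s (fun j => |X m j a * X m j b|) (c * c) fun j _ => by
    rw [abs_mul]
    gcongr <;> exact hbdd _ _ _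
  rwa [hs, nsmul_eq_mul] at this

theorem tendsto_rows_gram_of_blocksConverge (hk : ∀ᶠ n in atTop, 1 ≤ k n ∧ k n < n) {lam : ℝ}
    (hlam : Tendsto (fun n : ℕ => (k n : ℝ) / n) atTop (𝓝 lam)) (hB : BlocksConverge X k Sig) :
    Tendsto (fun j : Σ m : ℕ, Finset (Fin m) =>
      (j.1 : ℝ)⁻¹ • ((rows (X j.1) j.2)ᵀ * rows (X j.1) j.2))
      (blockFilter atTop (fun m => m) k) (𝓝 (lam • Sig)) := by
  have h1 : Tendsto (fun j : Σ m : ℕ, Finset (Fin m) =>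
      (k j.1 : ℝ)⁻¹ • ((rows (X j.1) j.2)ᵀ * rows (X j.1) j.2))
      (blockFilter atTop (fun m => m) k) (𝓝 Sig) := fun U hU =>
    eventually_blockFilter.2 (hB U hU)
  refine ((hlam.comp tendsto_fst_blockFilter).smul h1).congr' ?_
  filter_upwards [eventually_fst_blockFilter hk] with j hj
  have : (k j.1 : ℝ) ≠ 0 := by
    have := hj.1
    positivity
  rw [smul_smul]
  congr 1
  simp only [Function.comp_apply]
  field_simp

end Blocks

/-- The regime of a random sample, uniformly near a point of the parameter space. -/
theorem regime_probFilter {Ω : Type*} [MeasurableSpace Ω] {P : Measure Ω} [IsProbabilityMeasure P]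
    {p : ℕ} {σ : ℝ} (hσ : 0 < σ)
    {X : (n : ℕ) → Matrix (Fin n) (Fin p) ℝ} {ε : ℕ → Ω → ℝ}
    (hindep : iIndepFun ε P) (hident : ∀ i, IdentDistrib (ε i) (ε 0) P P)
    (hmean : ∀ i, ∫ ω, ε i ω ∂P = 0) (hvar : ∀ i, variance (ε i) P = σ ^ 2)
    (hmom : ∀ i, Integrable (fun ω => |ε i ω| ^ 4) P)
    {Sig : Matrix (Fin p) (Fin p) ℝ} (hSig : Sig.PosDef)
    (hX : Tendsto (fun n : ℕ => (n : ℝ)⁻¹ • ((X n)ᵀ * X n)) atTop (𝓝 Sig))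
    {c : ℝ} (hc : 0 ≤ c) (hbdd : ∀ m i a, |X m i a| ≤ c)
    {k : ℕ → ℕ} (hk : ∀ᶠ n in atTop, 1 ≤ k n ∧ k n < n)
    {lam : ℝ} (hlam : Tendsto (fun n : ℕ => (k n : ℝ) / n) atTop (𝓝 lam)) (hlam1 : lam < 1)
    (hblock : Tendsto (fun j : Σ m : ℕ, Finset (Fin m) =>
      (j.1 : ℝ)⁻¹ • ((rows (X j.1) j.2)ᵀ * rows (X j.1) j.2))
      (blockFilter atTop (fun m => m) k) (𝓝 (lam • Sig)))
    {E : Type*} {lE : Filter E} {K : E → Matrix (Fin p) (Fin p) ℝ}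
    {K₀ : Matrix (Fin p) (Fin p) ℝ} (hpd : ∀ᶠ η in lE, (K η).PosDef) (hpd₀ : K₀.PosDef)
    (hK : Tendsto K lE (𝓝 K₀)) :
    Regime (probFilter P ×ˢ lE) (fun x => x.1.1) k X σ lam Sig (fun x j => ε j x.1.2)
      (fun x => K x.2) K₀ where
  hn := tendsto_fst_probFilter.comp tendsto_fst
  hk := hk
  hlam := hlam
  hlam1 := hlam1
  hσ := hσ
  hSig := hSig
  hX := hX
  hbdd := ⟨c, hc, hbdd⟩
  hblock := tendsto_rows_gram_comp (tendsto_fst_probFilter.comp tendsto_fst) hblock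
  hpd := tendsto_snd.eventually hpd
  hpd₀ := hpd₀
  hK := hK.comp tendsto_snd
  hmom1 := fun a => ((noise_means hindep hident hmean hvar hmom
    (w := fun m j => X m j a) fun m j => hbdd m j a).1).comp tendsto_fst
  hmom2 := fun a b => ((noise_means hindep hident hmean hvar hmom
    (w := fun m j => X m j a * X m j b) (C := c * c) fun m j => by
      rw [abs_mul]; gcongr <;> exact hbdd _ _ _).2).comp tendsto_fst
  hmom3 := fun a b d => ((noise_means hindep hident hmean hvar hmom
    (w := fun m j => X m j a * X m j b * X m j d) (C := c * c * c) fun m j => by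
      rw [abs_mul, abs_mul]; gcongr <;> exact hbdd _ _ _).1).comp tendsto_fst


/-! ### Functions with bounded partial derivatives -/

section AxisPaths
variable {m : ℕ}

theorem euclidean_norm_le_of_abs_le {v w : EuclideanSpace ℝ (Fin m)} (h : ∀ i, |w i| ≤ |v i|) :
    ‖w‖ ≤ ‖v‖ := by
  rw [EuclideanSpace.norm_eq, EuclideanSpace.norm_eq]
  refine Real.sqrt_le_sqrt (Finset.sum_le_sum fun i _ => ?_)
  simp only [Real.norm_eq_abs]
  exact pow_le_pow_left₀ (abs_nonneg _) (h i) 2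

/-- A function with bounded partial derivatives on a ball varies little from its value at the
center: join the points by a path parallel to the axes. -/
theorem abs_sub_le_of_partial_le {h : EuclideanSpace ℝ (Fin m) → ℝ}
    {h' : Fin m → EuclideanSpace ℝ (Fin m) → ℝ} {c : EuclideanSpace ℝ (Fin m)} {r M : ℝ}
    (hd : ∀ i, ∀ η ∈ Metric.closedBall c r,
      HasDerivAt (fun t : ℝ => h (η + t • EuclideanSpace.single i 1)) (h' i η) 0)
    (hM : ∀ i, ∀ η ∈ Metric.closedBall c r, |h' i η| ≤ M)
    {η : EuclideanSpace ℝ (Fin m)} (hη : η ∈ Metric.closedBall c r) :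
    |h η - h c| ≤ m * (M * r) := by
  set v := η - c with hv
  have hvr : ‖v‖ ≤ r := by rwa [Metric.mem_closedBall, dist_eq_norm] at hη
  -- The vertices of the path: `tr J` has the coordinates of `η` in `J` and those of `c` elsewhere.
  set tr : Finset (Fin m) → EuclideanSpace ℝ (Fin m) := fun J =>
    c + WithLp.toLp 2 (fun i => if i ∈ J then v i else 0) with htr
  have hind : ∀ J : Finset (Fin m), |h (tr J) - h c| ≤ J.card * (M * r) := by
    intro J
    induction J using Finset.induction_on with
    | empty =>
      have : tr ∅ = c := by
        simp only [htr, Finset.notMem_empty, if_false]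
        ext i; simp
      simp [this]
    | insert j J hj ih =>
      have hball : ∀ s ∈ Set.uIcc 0 (v j),
          tr J + s • EuclideanSpace.single j (1 : ℝ) ∈ Metric.closedBall c r := by
        intro s hs
        rw [Metric.mem_closedBall, dist_eq_norm]
        -- Relative to `c`, each coordinate of a point of the path is dominated by that of `v`, so
        -- the path stays in the ball.
        refine le_trans (euclidean_norm_le_of_abs_le fun i => ?_) hvr
        have hs' : |s| ≤ |v j| := by
          have := Set.abs_sub_left_of_mem_uIcc hs
          simpa using this
        by_cases hij : i = j
        · subst hij
          simp [htr, hj, hs']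
        · by_cases hiJ : i ∈ J <;> simp [htr, hiJ, hij]
      have hder : ∀ s ∈ Set.uIcc 0 (v j), HasDerivWithinAt
          (fun s : ℝ => h (tr J + s • EuclideanSpace.single j (1 : ℝ)))
          (h' j (tr J + s • EuclideanSpace.single j (1 : ℝ))) (Set.uIcc 0 (v j)) s := by
        intro s hs
        have h1 := hd j _ (hball s hs)
        rw [← sub_self s] at h1
        have h2 := h1.comp_sub_const s s
        refine (h2.congr_of_eventuallyEq (Eventually.of_forall fun t => ?_)).hasDerivWithinAt
        simp only [add_assoc, ← add_smul]
        congr 3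
        ring
      have hmvt := (convex_uIcc (0 : ℝ) (v j)).norm_image_sub_le_of_norm_hasDerivWithin_le hder
        (fun s hs => hM j _ (hball s hs)) Set.left_mem_uIcc Set.right_mem_uIcc
      have hins : tr (insert j J) = tr J + v j • EuclideanSpace.single j (1 : ℝ) := by
        ext i
        by_cases hij : i = j
        · subst hij; simp [htr, hj]
        · simp [htr, hij]
      have hM0 : 0 ≤ M := (abs_nonneg _).trans (hM j _ (hball 0 Set.left_mem_uIcc))
      have hvj : |v j| ≤ r := by
        refine le_trans ?_ hvr
        simpa using PiLp.norm_apply_le v j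
      rw [zero_smul, add_zero, ← hins, Real.norm_eq_abs, Real.norm_eq_abs, sub_zero] at hmvt
      have hle : M * |v j| ≤ M * r := mul_le_mul_of_nonneg_left hvj hM0
      rw [Finset.card_insert_of_notMem hj]
      push_cast
      calc |h (tr (insert j J)) - h c|
          = |(h (tr (insert j J)) - h (tr J)) + (h (tr J) - h c)| := by ring_nf
        _ ≤ M * r + J.card * (M * r) := (abs_add_le _ _).trans (add_le_add (hmvt.trans hle) ih)
        _ = _ := by ring
  have huniv : tr Finset.univ = η := by
    ext i
    simp [htr, hv]
  have := hind Finset.univ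
  rwa [huniv, Finset.card_univ, Fintype.card_fin] at this

/-- The increment bound, used on the ball of radius `dist η c`, is a Lipschitz estimate at `c`. -/
theorem continuousAt_of_partial_le {h : EuclideanSpace ℝ (Fin m) → ℝ}
    {h' : Fin m → EuclideanSpace ℝ (Fin m) → ℝ} {c : EuclideanSpace ℝ (Fin m)} {r M : ℝ}
    (hr : 0 < r) (hd : ∀ i, ∀ η ∈ Metric.closedBall c r,
      HasDerivAt (fun t : ℝ => h (η + t • EuclideanSpace.single i 1)) (h' i η) 0)
    (hM : ∀ i, ∀ η ∈ Metric.closedBall c r, |h' i η| ≤ M) : ContinuousAt h c := by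
  rw [ContinuousAt, tendsto_iff_dist_tendsto_zero]
  have hlim : Tendsto (fun η => m * (M * dist η c)) (𝓝 c) (𝓝 0) := by
    have : Tendsto (fun η => dist η c) (𝓝 c) (𝓝 0) := tendsto_iff_dist_tendsto_zero.1 tendsto_id
    simpa using (this.const_mul M).const_mul (m : ℝ)
  refine squeeze_zero' (Eventually.of_forall fun _ => dist_nonneg) ?_ hlim
  filter_upwards [Metric.closedBall_mem_nhds c hr] with η hη
  have hsub : Metric.closedBall c (dist η c) ⊆ Metric.closedBall c r :=
    Metric.closedBall_subset_closedBall hη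
  exact abs_sub_le_of_partial_le (fun i x hx => hd i x (hsub hx))
    (fun i x hx => hM i x (hsub hx)) (Metric.mem_closedBall.2 le_rfl)

theorem exists_bound_of_continuousOn {h' : Fin m → EuclideanSpace ℝ (Fin m) → ℝ}
    {S : Set (EuclideanSpace ℝ (Fin m))} (hS : IsCompact S) (hc : ∀ i, ContinuousOn (h' i) S) :
    ∃ M, 0 ≤ M ∧ ∀ i, ∀ η ∈ S, |h' i η| ≤ M := by
  choose M hM using fun i => hS.exists_bound_of_continuousOn (hc i)
  refine ⟨∑ i, |M i|, Finset.sum_nonneg fun _ _ => abs_nonneg _, fun i η hη => ?_⟩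
  exact (hM i η hη).trans ((le_abs_self _).trans
    (Finset.single_le_sum (f := fun i => |M i|) (fun _ _ => abs_nonneg _) (Finset.mem_univ i)))

/-- A function with continuous partial derivatives on an open set is continuous there. -/
theorem continuousOn_of_continuousOn_partial {h : EuclideanSpace ℝ (Fin m) → ℝ}
    {h' : Fin m → EuclideanSpace ℝ (Fin m) → ℝ} {U : Set (EuclideanSpace ℝ (Fin m))}
    (hU : IsOpen U) (hd : ∀ i, ∀ η ∈ U,
      HasDerivAt (fun t : ℝ => h (η + t • EuclideanSpace.single i 1)) (h' i η) 0)
    (hc : ∀ i, ContinuousOn (h' i) U) : ContinuousOn h U := by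
  intro x hx
  obtain ⟨r, hr, hrU⟩ := Metric.nhds_basis_closedBall.mem_iff.1 (hU.mem_nhds hx)
  obtain ⟨M, -, hM⟩ := exists_bound_of_continuousOn (isCompact_closedBall x r)
    fun i => (hc i).mono hrU
  exact (continuousAt_of_partial_le hr (fun i η hη => hd i η (hrU hη)) hM).continuousWithinAt

end AxisPaths

/-! ### From gradients to roots of the first order conditions -/

/-- `f` has a gradient at positive definite matrices, in the sense that the chain rule holds along
curves. -/
def HasGradOnPosDef {p : ℕ} (f : Matrix (Fin p) (Fin p) ℝ → ℝ) : Prop :=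
  ∀ (M : ℝ → Matrix (Fin p) (Fin p) ℝ) (M' : Matrix (Fin p) (Fin p) ℝ) (t : ℝ),
    HasEntryDerivAt M M' t → (M t).PosDef →
      HasDerivAt (fun r => f (M r)) (∑ a, ∑ b, matrixDeriv f (M t) a b * M' a b) t

theorem hasGradOnPosDef_lkocv {n p : ℕ} {σ : ℝ} (hσ : 0 < σ) (k : ℕ)
    (X : Matrix (Fin n) (Fin p) ℝ) (y : Fin n → ℝ) : HasGradOnPosDef (lkocv σ k X y) :=
  fun _ _ _ h hM => by
    rw [matrixDeriv_lkocv hσ k X y hM]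
    exact hasDerivAt_lkocv hσ k X y h hM

theorem hasGradOnPosDef_limitRisk {p : ℕ} (β : Fin p → ℝ) {Sig : Matrix (Fin p) (Fin p) ℝ}
    (hSig : Sig.PosDef) : HasGradOnPosDef (limitRisk β Sig) :=
  fun _ _ _ h hM => by
    rw [matrixDeriv_limitRisk β hSig hM]
    exact hasDerivAt_limitRisk β hSig h hM

section Parameter
variable {p m : ℕ} {Θ : Set (EuclideanSpace ℝ (Fin m))}
  {K : EuclideanSpace ℝ (Fin m) → Matrix (Fin p) (Fin p) ℝ}

theorem hasEntryDerivAt_partialDeriv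
    (hKdiff : ∀ (i : Fin m) (a b : Fin p), ∀ η ∈ interior Θ,
      LineDifferentiableAt ℝ (fun η' => K η' a b) η (EuclideanSpace.single i 1))
    (i : Fin m) {η : EuclideanSpace ℝ (Fin m)} (hη : η ∈ interior Θ) :
    HasEntryDerivAt (fun t : ℝ => K (η + t • EuclideanSpace.single i 1)) (partialDeriv K i η) 0 :=
  fun a b => (hKdiff i a b η hη).hasLineDerivAt

theorem tendsto_line (η : EuclideanSpace ℝ (Fin m)) (i : Fin m) :
    Tendsto (fun t : ℝ => η + t • EuclideanSpace.single i (1 : ℝ)) (𝓝 0) (𝓝 η) := by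
  have : Continuous fun t : ℝ => η + t • EuclideanSpace.single i (1 : ℝ) := by fun_prop
  simpa using this.tendsto 0

/-- `K` is symmetric on an open set, so its entries `a b` and `b a` agree along short segments. This
allows the chain rule to be written as the trace of `D * H` instead of `D * Hᵀ`. -/
theorem partialDeriv_transpose (hK : ∀ η ∈ interior Θ, (K η).PosDef)
    (hKdiff : ∀ (i : Fin m) (a b : Fin p), ∀ η ∈ interior Θ,
      LineDifferentiableAt ℝ (fun η' => K η' a b) η (EuclideanSpace.single i 1))
    (i : Fin m) {η : EuclideanSpace ℝ (Fin m)} (hη : η ∈ interior Θ) :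
    (partialDeriv K i η)ᵀ = partialDeriv K i η := by
  have h := hasEntryDerivAt_partialDeriv hKdiff i hη
  ext a b
  refine (h b a).unique ((h a b).congr_of_eventuallyEq ?_)
  filter_upwards [(tendsto_line η i).eventually (isOpen_interior.mem_nhds hη)] with t ht
  exact congrFun (congrFun (transpose_eq_of_posDef (hK _ ht)) a) b

/-- The chain rule for the partial derivatives of `η ↦ f (K η)`. -/
theorem hasDerivAt_comp_partial {f : Matrix (Fin p) (Fin p) ℝ → ℝ} (hf : HasGradOnPosDef f)
    (hK : ∀ η ∈ interior Θ, (K η).PosDef)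
    (hKdiff : ∀ (i : Fin m) (a b : Fin p), ∀ η ∈ interior Θ,
      LineDifferentiableAt ℝ (fun η' => K η' a b) η (EuclideanSpace.single i 1))
    (i : Fin m) {η : EuclideanSpace ℝ (Fin m)} (hη : η ∈ interior Θ) :
    HasDerivAt (fun t : ℝ => f (K (η + t • EuclideanSpace.single i 1)))
      (matrixDeriv f (K η) * partialDeriv K i η).trace 0 := by
  have h := hf _ _ 0 (hasEntryDerivAt_partialDeriv hKdiff i hη) (by simpa using hK η hη)
  rw [sum_mul_eq_trace, partialDeriv_transpose hK hKdiff i hη] at h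
  simpa using h

theorem continuousOn_kernel
    (hKdiff : ∀ (i : Fin m) (a b : Fin p), ∀ η ∈ interior Θ,
      LineDifferentiableAt ℝ (fun η' => K η' a b) η (EuclideanSpace.single i 1))
    (hKcont : ∀ i : Fin m, ContinuousOn (partialDeriv K i) (interior Θ)) :
    ContinuousOn K (interior Θ) := by
  refine continuousOn_pi.2 fun a => continuousOn_pi.2 fun b => ?_
  exact continuousOn_of_continuousOn_partial (h' := fun i η => partialDeriv K i η a b)
    isOpen_interior (fun i η hη => hasEntryDerivAt_partialDeriv hKdiff i hη a b)
    fun i => continuousOn_pi.1 (continuousOn_pi.1 (hKcont i) a) b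

theorem mem_rootSet_of_isLocalMin {f : Matrix (Fin p) (Fin p) ℝ → ℝ} (hf : HasGradOnPosDef f)
    (hK : ∀ η ∈ interior Θ, (K η).PosDef)
    (hKdiff : ∀ (i : Fin m) (a b : Fin p), ∀ η ∈ interior Θ,
      LineDifferentiableAt ℝ (fun η' => K η' a b) η (EuclideanSpace.single i 1))
    {η : EuclideanSpace ℝ (Fin m)} (hη : η ∈ interior Θ)
    (hmin : IsLocalMin (fun η => f (K η)) η) : η ∈ rootSet f K Θ := by
  refine ⟨hη, fun i => ?_⟩
  refine IsLocalMin.hasDerivAt_eq_zero ?_ (hasDerivAt_comp_partial hf hK hKdiff i hη)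
  have := (tendsto_line η i).eventually hmin
  simpa [IsLocalMin, IsMinFilter] using this

/-- If the gradients of the criteria, suitably normalized, converge in probability to a positive
multiple of the gradient of `W`, locally uniformly in the parameter, then asymptotic optimality to
the first order holds. -/
theorem isAOFirstOrder_of_tendsto {Ω : Type*} [MeasurableSpace Ω] {P : Measure Ω}
    {C : ℕ → Ω → Matrix (Fin p) (Fin p) ℝ → ℝ} {W : Matrix (Fin p) (Fin p) ℝ → ℝ}
    (hC : ∀ n ω, HasGradOnPosDef (C n ω)) (hW : HasGradOnPosDef W)
    (hK : ∀ η ∈ interior Θ, (K η).PosDef)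
    (hKdiff : ∀ (i : Fin m) (a b : Fin p), ∀ η ∈ interior Θ,
      LineDifferentiableAt ℝ (fun η' => K η' a b) η (EuclideanSpace.single i 1))
    (hmin : (minimizers W K Θ).Nonempty) (hmin_int : minimizers W K Θ ⊆ interior Θ)
    (hmin_iso : ∀ η ∈ minimizers W K Θ,
      ∃ r > 0, ∀ η' ∈ minimizers W K Θ, dist η' η < r → η' = η)
    (hWcont : ∀ i, ContinuousOn (fun η => (matrixDeriv W (K η) * partialDeriv K i η).trace)
      (interior Θ))
    {c : ℝ} (hc : 0 < c)
    (hconv : ∀ η₀ ∈ interior Θ, ∀ i, Tendsto (fun x : (ℕ × Ω) × EuclideanSpace ℝ (Fin m) =>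
      (x.1.1 : ℝ) ^ 2 * (matrixDeriv (C x.1.1 x.1.2) (K x.2) * partialDeriv K i x.2).trace)
      (probFilter P ×ˢ 𝓝 η₀) (𝓝 (c * (matrixDeriv W (K η₀) * partialDeriv K i η₀).trace))) :
    IsAOFirstOrder P C W K Θ := by
  intro δ hδ
  obtain ⟨ηs, hηs⟩ := hmin
  have hηsU := hmin_int hηs
  obtain ⟨r₁, hr₁, hiso⟩ := hmin_iso ηs hηs
  obtain ⟨r₂, hr₂, hball⟩ := Metric.nhds_basis_closedBall.mem_iff.1
    (isOpen_interior.mem_nhds hηsU)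
  obtain ⟨r₃, hr₃0, hr₃⟩ : ∃ r₃ : ℝ, 0 < r₃ ∧ ENNReal.ofReal r₃ < δ := by
    obtain ⟨q, hq0, hq⟩ := ENNReal.lt_iff_exists_nnreal_btwn.1 hδ
    exact ⟨q, by exact_mod_cast hq0, by simpa using hq⟩
  -- `r₁` isolates the minimizer, `r₃` gives the distance below `δ`, and `r₂ / 2` leaves room for
  -- balls of radius `r₂ / 2` around every point of the small ball.
  set r := min (r₁ / 2) (min (r₂ / 2) r₃) with hr
  have hr0 : 0 < r := by positivity
  have hrr₁ : r < r₁ := lt_of_le_of_lt (min_le_left _ _) (by linarith)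
  have hrr₂ : r + r₂ / 2 ≤ r₂ := by
    have : r ≤ r₂ / 2 := (min_le_right _ _).trans (min_le_left _ _)
    linarith
  have hrr₃ : r ≤ r₃ := (min_le_right _ _).trans (min_le_right _ _)
  have hrball : Metric.closedBall ηs r ⊆ Metric.closedBall ηs r₂ :=
    Metric.closedBall_subset_closedBall (by linarith)
  set gW : Fin m → EuclideanSpace ℝ (Fin m) → ℝ := fun i η =>
    (matrixDeriv W (K η) * partialDeriv K i η).trace with hgW
  have hdW : ∀ i, ∀ η ∈ interior Θ,
      HasDerivAt (fun t : ℝ => W (K (η + t • EuclideanSpace.single i 1))) (gW i η) 0 :=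
    fun i η hη => hasDerivAt_comp_partial hW hK hKdiff i hη
  have hWKcont : ContinuousOn (fun η => W (K η)) (interior Θ) :=
    continuousOn_of_continuousOn_partial isOpen_interior hdW hWcont
  have hsΘ : ∀ η ∈ Metric.closedBall ηs r₂, W (K ηs) ≤ W (K η) := fun η hη =>
    hηs.2.2 η (interior_subset (hball hη)) (hK η (hball hη))
  have hroot : ηs ∈ rootSet W K Θ := mem_rootSet_of_isLocalMin hW hK hKdiff hηsU
    (Filter.mem_of_superset (Metric.closedBall_mem_nhds ηs hr₂) hsΘ)
  -- On the compact sphere `W` exceeds its minimum by a definite gap, since a point with equal value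
  -- would be a second global minimizer closer than `r₁`. The sphere may be empty, as for `m = 0`.
  obtain ⟨κ, hκ0, hκ⟩ : ∃ κ > 0, ∀ η ∈ Metric.sphere ηs r, W (K ηs) + κ ≤ W (K η) := by
    rcases (Metric.sphere ηs r).eq_empty_or_nonempty with he | hne
    · exact ⟨1, one_pos, fun η hη => by simp [he] at hη⟩
    · obtain ⟨η₀, hη₀, hη₀min⟩ := (isCompact_sphere ηs r).exists_isMinOn hne
        (hWKcont.mono fun η hη => hball (hrball (Metric.sphere_subset_closedBall hη)))
      have hη₀b := hrball (Metric.sphere_subset_closedBall hη₀)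
      have hlt : W (K ηs) < W (K η₀) := by
        by_contra hle
        have hmem : η₀ ∈ minimizers W K Θ := ⟨interior_subset (hball hη₀b), hK _ (hball hη₀b),
          fun η' hη' hp => (not_lt.1 hle).trans (hηs.2.2 η' hη' hp)⟩
        have hd : dist η₀ ηs = r := hη₀
        have := hiso η₀ hmem (by rw [hd]; exact hrr₁)
        rw [this, dist_self] at hd
        linarith
      exact ⟨W (K η₀) - W (K ηs), sub_pos.2 hlt, fun η hη => by
        have : W (K η₀) ≤ W (K η) := hη₀min hη
        linarith⟩
  -- An error `κ'` in each partial derivative adds up to at most `m κ' r < c κ` along an axis path;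
  -- `m + 1` avoids dividing by zero when `m = 0`.
  set κ' := c * κ / (2 * ((m + 1) * r)) with hκ'
  have hκ'0 : 0 < κ' := by positivity
  have hκ'lt : m * (κ' * r) < c * κ := by
    have e1 : κ' * r = c * κ / (2 * (m + 1)) := by
      rw [hκ']; field_simp
    rw [e1, mul_div_assoc', div_lt_iff₀ (by positivity)]
    have : (0 : ℝ) ≤ m := m.cast_nonneg
    nlinarith [mul_pos hc hκ0]
  have hgood : ∀ᶠ x in probFilter P, ∀ η ∈ Metric.closedBall ηs r₂, ∀ i,
      |(x.1 : ℝ) ^ 2 * (matrixDeriv (C x.1 x.2) (K η) * partialDeriv K i η).trace -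
        c * gW i η| < κ' := by
    have hloc : ∀ η₀ ∈ Metric.closedBall ηs r₂, ∀ᶠ x in probFilter P ×ˢ 𝓝 η₀, ∀ i,
        |(x.1.1 : ℝ) ^ 2 * (matrixDeriv (C x.1.1 x.1.2) (K x.2) * partialDeriv K i x.2).trace -
          c * gW i x.2| < κ' := by
      intro η₀ hη₀
      refine eventually_all.2 fun i => ?_
      have h1 := hconv η₀ (hball hη₀) i
      have h2 : Tendsto (gW i) (𝓝 η₀) (𝓝 (gW i η₀)) :=
        ((hWcont i).continuousAt (isOpen_interior.mem_nhds (hball hη₀)))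
      have h3 := h1.sub ((h2.comp tendsto_snd).const_mul c)
      rw [sub_self] at h3
      have h4 := (Metric.tendsto_nhds.1 h3) κ' hκ'0
      simpa [Real.dist_eq] using h4
    have h5 : ∀ᶠ x in probFilter P ×ˢ 𝓝ˢ (Metric.closedBall ηs r₂), ∀ i,
        |(x.1.1 : ℝ) ^ 2 * (matrixDeriv (C x.1.1 x.1.2) (K x.2) * partialDeriv K i x.2).trace -
          c * gW i x.2| < κ' := by
      -- Compactness of the ball turns local uniformity in the parameter into uniformity on a single
      -- event of probability tending to one.
      rw [(isCompact_closedBall ηs r₂).prod_nhdsSet_eq_biSup]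
      simpa [eventually_iSup] using hloc
    obtain ⟨pa, hpa, pb, hpb, hab⟩ := eventually_prod_iff.1 h5
    filter_upwards [hpa] with x hx η hη i
    exact hab hx (hpb.self_of_nhdsSet η hη) i
  suffices hev : ∀ᶠ x in probFilter P,
      ¬ δ ≤ setGap (rootSet (C x.1 x.2) K Θ) (rootSet W K Θ) by
    simpa using eventually_probFilter.1 hev
  obtain ⟨B, hB0, hB⟩ := exists_bound_of_continuousOn (isCompact_closedBall ηs r₂)
    fun i => (hWcont i).mono hball
  filter_upwards [hgood, tendsto_fst_probFilter.eventually (eventually_ge_atTop 1)] with x hx hn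
  have hn0 : (0 : ℝ) < (x.1 : ℝ) ^ 2 := by
    have : (0 : ℝ) < x.1 := by exact_mod_cast hn
    positivity
  set gC : Fin m → EuclideanSpace ℝ (Fin m) → ℝ := fun i η =>
    (matrixDeriv (C x.1 x.2) (K η) * partialDeriv K i η).trace with hgC
  have hdC : ∀ i, ∀ η ∈ interior Θ,
      HasDerivAt (fun t : ℝ => C x.1 x.2 (K (η + t • EuclideanSpace.single i 1))) (gC i η) 0 :=
    fun i η hη => hasDerivAt_comp_partial (hC _ _) hK hKdiff i hη
  have hgCB : ∀ i, ∀ η ∈ Metric.closedBall ηs r₂, |gC i η| ≤ (κ' + c * B) / (x.1 : ℝ) ^ 2 := by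
    intro i η hη
    rw [le_div_iff₀ hn0, ← abs_of_pos hn0, ← abs_mul, mul_comm]
    calc |(x.1 : ℝ) ^ 2 * gC i η| = |((x.1 : ℝ) ^ 2 * gC i η - c * gW i η) + c * gW i η| := by
          ring_nf
      _ ≤ κ' + c * B := by
        refine (abs_add_le _ _).trans (add_le_add (hx η hη i).le ?_)
        rw [abs_mul, abs_of_pos hc]
        exact mul_le_mul_of_nonneg_left (hB i η hη) hc.le
  have hCcont : ContinuousOn (fun η => C x.1 x.2 (K η)) (Metric.closedBall ηs r) := by
    intro η hη
    have hsub : Metric.closedBall η (r₂ / 2) ⊆ Metric.closedBall ηs r₂ :=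
      Metric.closedBall_subset_closedBall' (by
        have : dist η ηs ≤ r := hη
        linarith)
    exact (continuousAt_of_partial_le (h := fun η => C x.1 x.2 (K η)) (half_pos hr₂)
      (fun i x hx => hdC i x (hball (hsub hx)))
      (fun i x hx => hgCB i x (hsub hx))).continuousWithinAt
  obtain ⟨η₁, hη₁, hη₁min⟩ := (isCompact_closedBall ηs r).exists_isMinOn
    ⟨ηs, Metric.mem_closedBall_self hr0.le⟩ hCcont
  -- The increments from `ηs` of `n² C` and of `c W` differ by at most `m κ' r`; their values need
  -- not be close.
  have hdiff := abs_sub_le_of_partial_le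
    (h := fun η => (x.1 : ℝ) ^ 2 * C x.1 x.2 (K η) - c * W (K η))
    (h' := fun i η => (x.1 : ℝ) ^ 2 * gC i η - c * gW i η) (c := ηs) (r := r) (M := κ')
    (fun i η hη => ((hdC i η (hball (hrball hη))).const_mul _).sub
      ((hdW i η (hball (hrball hη))).const_mul c))
    (fun i η hη => (hx η (hrball hη) i).le) hη₁
  have hη₁lt : dist η₁ ηs < r := by
    -- At a minimizer on the sphere `c W` would have grown by `c κ`, more than the error in the
    -- increments, so `C` would be larger there than at the center.
    refine lt_of_le_of_ne hη₁ fun heq => ?_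
    have h1 := hκ η₁ heq
    have h2 : C x.1 x.2 (K η₁) ≤ C x.1 x.2 (K ηs) :=
      hη₁min (Metric.mem_closedBall_self hr0.le)
    have h3 := mul_le_mul_of_nonneg_left h2 hn0.le
    have h4 := mul_le_mul_of_nonneg_left h1 hc.le
    have h5 := (abs_le.1 hdiff).1
    linarith
  have hη₁root : η₁ ∈ rootSet (C x.1 x.2) K Θ :=
    mem_rootSet_of_isLocalMin (hC _ _) hK hKdiff (hball (hrball hη₁))
      (hη₁min.isLocalMin (Filter.mem_of_superset (Metric.isOpen_ball.mem_nhds hη₁lt)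
        Metric.ball_subset_closedBall))
  refine not_le.2 (lt_of_le_of_lt ?_ hr₃)
  calc setGap (rootSet (C x.1 x.2) K Θ) (rootSet W K Θ) ≤ edist η₁ ηs :=
        iInf₂_le_of_le η₁ hη₁root (iInf₂_le ηs hroot)
    _ ≤ ENNReal.ofReal r₃ := by
      rw [edist_dist]
      exact ENNReal.ofReal_le_ofReal (hη₁.trans hrr₃)

end Parameter

/-! ### Assembly -/

theorem tendsto_limitRiskGrad {ι : Type*} {l : Filter ι} {p : ℕ} (β : Fin p → ℝ)
    (Sig : Matrix (Fin p) (Fin p) ℝ) {Km : ι → Matrix (Fin p) (Fin p) ℝ}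
    {K₀ : Matrix (Fin p) (Fin p) ℝ} (hK : Tendsto Km l (𝓝 K₀)) (hK₀ : K₀.PosDef) :
    Tendsto (fun i => limitRiskGrad β Sig (Km i)) l (𝓝 (limitRiskGrad β Sig K₀)) := by
  have hi := tendsto_matrix_inv hK hK₀.isUnit
  have hQ := (hi.mul (tendsto_const_nhds (x := Sig⁻¹))).mul hi
  have hv := tendsto_matrix_mulVec hi (tendsto_const_nhds (x := β))
  have hw := tendsto_matrix_mulVec hQ (tendsto_const_nhds (x := β))
  have hvec : ∀ {v w : ι → Fin p → ℝ} {v₀ w₀ : Fin p → ℝ}, Tendsto v l (𝓝 v₀) →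
      Tendsto w l (𝓝 w₀) → Tendsto (fun i => vecMulVec (v i) (w i)) l (𝓝 (vecMulVec v₀ w₀)) :=
    fun h1 h2 => tendsto_pi_nhds.2 fun a => tendsto_pi_nhds.2 fun b =>
      (tendsto_pi_nhds.1 h1 a).mul (tendsto_pi_nhds.1 h2 b)
  exact ((hQ.const_smul (2 : ℝ)).sub (hvec hv hw)).sub (hvec hw hv)

/-- Paired with a symmetric matrix, the limit of the gradients of the cross validation criterion is
a multiple of the gradient of the limiting risk. -/
theorem trace_limit_gradient {p : ℕ} (β : Fin p → ℝ) (c : ℝ) (Sig : Matrix (Fin p) (Fin p) ℝ)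
    {K H : Matrix (Fin p) (Fin p) ℝ} (hK : K.PosDef) (hH : Hᵀ = H) :
    (((2 * c) • (K⁻¹ * Sig⁻¹ * K⁻¹ * (K - vecMulVec β β) * K⁻¹)) * H).trace =
      c * (limitRiskGrad β Sig K * H).trace := by
  have hu := (Matrix.isUnit_iff_isUnit_det _).1 hK.isUnit
  have hKs := transpose_eq_of_posDef hK.inv
  have e1 : K⁻¹ * Sig⁻¹ * K⁻¹ * (K - vecMulVec β β) * K⁻¹ = K⁻¹ * Sig⁻¹ * K⁻¹ -
      vecMulVec ((K⁻¹ * Sig⁻¹ * K⁻¹) *ᵥ β) (K⁻¹ *ᵥ β) := by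
    rw [Matrix.mul_sub, Matrix.sub_mul, Matrix.mul_vecMulVec, vecMulVec_mul_of_transpose_eq hKs]
    congr 1
    rw [Matrix.mul_assoc _ _ K, Matrix.nonsing_inv_mul _ hu, Matrix.mul_one]
  -- Transposition exchanges the two rank one terms, and the symmetric `H` does not distinguish
  -- them.
  have e2 : (vecMulVec (K⁻¹ *ᵥ β) ((K⁻¹ * Sig⁻¹ * K⁻¹) *ᵥ β) * H).trace =
      (vecMulVec ((K⁻¹ * Sig⁻¹ * K⁻¹) *ᵥ β) (K⁻¹ *ᵥ β) * H).trace := by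
    rw [← Matrix.trace_transpose, Matrix.transpose_mul, Matrix.transpose_vecMulVec, hH,
      Matrix.trace_mul_comm]
  rw [e1, limitRiskGrad, Matrix.smul_mul, Matrix.trace_smul, Matrix.sub_mul, Matrix.sub_mul,
    Matrix.sub_mul, Matrix.trace_sub, Matrix.trace_sub, Matrix.trace_sub, e2, Matrix.smul_mul,
    Matrix.trace_smul]
  simp only [smul_eq_mul]
  ring

/-- Asymptotic optimality and convergence of the gradients, when the block Gram matrices converge
uniformly. -/
theorem isAOFirstOrder_and_tendsto_matrixDeriv
    {Ω : Type*} [MeasurableSpace Ω] {P : Measure Ω} [IsProbabilityMeasure P]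
    {p m : ℕ} (β : Fin p → ℝ) {σ : ℝ} (hσ : 0 < σ)
    {X : (n : ℕ) → Matrix (Fin n) (Fin p) ℝ} {ε : ℕ → Ω → ℝ}
    (hindep : iIndepFun ε P) (hident : ∀ i, IdentDistrib (ε i) (ε 0) P P)
    (hmean : ∀ i, ∫ ω, ε i ω ∂P = 0) (hvar : ∀ i, variance (ε i) P = σ ^ 2)
    {Sig : Matrix (Fin p) (Fin p) ℝ} (hSig : Sig.PosDef)
    (hX : Tendsto (fun n : ℕ => (n : ℝ)⁻¹ • ((X n)ᵀ * X n)) atTop (𝓝 Sig))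
    {Θ : Set (EuclideanSpace ℝ (Fin m))}
    {K : EuclideanSpace ℝ (Fin m) → Matrix (Fin p) (Fin p) ℝ}
    (hK : ∀ η ∈ interior Θ, (K η).PosDef)
    (hmin : (minimizers (limitRisk β Sig) K Θ).Nonempty)
    (hmin_int : minimizers (limitRisk β Sig) K Θ ⊆ interior Θ)
    (hmin_iso : ∀ η ∈ minimizers (limitRisk β Sig) K Θ,
      ∃ r > 0, ∀ η' ∈ minimizers (limitRisk β Sig) K Θ, dist η' η < r → η' = η)
    (hmom : ∀ i, Integrable (fun ω => |ε i ω| ^ 4) P)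
    {c : ℝ} (hc : 0 ≤ c) (hbdd : ∀ m i a, |X m i a| ≤ c)
    (hKdiff : ∀ (i : Fin m) (a b : Fin p), ∀ η ∈ interior Θ,
      LineDifferentiableAt ℝ (fun η' => K η' a b) η (EuclideanSpace.single i 1))
    (hKcont : ∀ i : Fin m, ContinuousOn (partialDeriv K i) (interior Θ))
    {k : ℕ → ℕ} (hk : ∀ᶠ n in atTop, 1 ≤ k n ∧ k n < n)
    {lam : ℝ} (hlam : Tendsto (fun n : ℕ => (k n : ℝ) / n) atTop (𝓝 lam)) (hlam1 : lam < 1)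
    (hblock : Tendsto (fun j : Σ m : ℕ, Finset (Fin m) =>
      (j.1 : ℝ)⁻¹ • ((rows (X j.1) j.2)ᵀ * rows (X j.1) j.2))
      (blockFilter atTop (fun m => m) k) (𝓝 (lam • Sig))) :
    IsAOFirstOrder P (fun n ω => lkocv σ (k n) (X n) (obs β (X n) ε ω)) (limitRisk β Sig) K Θ ∧
      ∀ η ∈ interior Θ, ∀ a b : Fin p,
        TendstoInMeasure P
          (fun (n : ℕ) ω => (n : ℝ) ^ 2 *
            matrixDeriv (lkocv σ (k n) (X n) (obs β (X n) ε ω)) (K η) a b)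
          atTop
          (fun _ => ((2 * σ ^ 4 / (1 - lam) ^ 2) •
            ((K η)⁻¹ * Sig⁻¹ * (K η)⁻¹ * (K η - vecMulVec β β) * (K η)⁻¹)) a b) := by
  have hKc := continuousOn_kernel hKdiff hKcont
  have hKt : ∀ η ∈ interior Θ, Tendsto K (𝓝 η) (𝓝 (K η)) := fun η hη =>
    hKc.continuousAt (isOpen_interior.mem_nhds hη)
  have hpd : ∀ η ∈ interior Θ, ∀ᶠ η' in 𝓝 η, (K η').PosDef := fun η hη =>
    Filter.mem_of_superset (isOpen_interior.mem_nhds hη) hK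
  have hgrad : ∀ η ∈ interior Θ, ∀ a b : Fin p,
      Tendsto (fun x : (ℕ × Ω) × EuclideanSpace ℝ (Fin m) => (x.1.1 : ℝ) ^ 2 *
        matrixDeriv (lkocv σ (k x.1.1) (X x.1.1) (obs β (X x.1.1) ε x.1.2)) (K x.2) a b)
        (probFilter P ×ˢ 𝓝 η) (𝓝 (((2 * σ ^ 4 / (1 - lam) ^ 2) •
          ((K η)⁻¹ * Sig⁻¹ * (K η)⁻¹ * (K η - vecMulVec β β) * (K η)⁻¹)) a b)) := by
    intro η hη a b
    have H := regime_probFilter hσ hindep hident hmean hvar hmom hSig hX hc hbdd hk hlam hlam1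
      hblock (hpd η hη) (hK η hη) (hKt η hη)
    refine (H.sq_mul_lkocvGrad β a b).congr' ?_
    filter_upwards [tendsto_snd.eventually (hpd η hη)] with x hx
    rw [matrixDeriv_lkocv hσ _ _ _ hx]
    rfl
  refine ⟨?_, fun η hη a b => tendstoInMeasure_of_tendsto_probFilter ?_⟩
  · have h1 : 0 < 1 - lam := by linarith
    refine isAOFirstOrder_of_tendsto (fun n ω => hasGradOnPosDef_lkocv hσ _ _ _)
      (hasGradOnPosDef_limitRisk β hSig) hK hKdiff hmin hmin_int hmin_iso (fun i => ?_)
      (c := σ ^ 4 / (1 - lam) ^ 2) (by positivity) fun η₀ hη₀ i => ?_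
    · intro η hη
      have t1 := (tendsto_limitRiskGrad β Sig (hKc η hη) (hK η hη)).mul (hKcont i η hη)
      have t2 : Tendsto (fun η => (limitRiskGrad β Sig (K η) * partialDeriv K i η).trace)
          (𝓝[interior Θ] η) (𝓝 (limitRiskGrad β Sig (K η) * partialDeriv K i η).trace) :=
        tendsto_finsetSum Finset.univ fun a _ =>
          tendsto_pi_nhds.1 (tendsto_pi_nhds.1 t1 a) a
      rw [ContinuousWithinAt, matrixDeriv_limitRisk β hSig (hK η hη)]
      refine t2.congr' ?_
      filter_upwards [self_mem_nhdsWithin] with η' hη'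
      rw [matrixDeriv_limitRisk β hSig (hK η' hη')]
    -- The limit of the gradients need not be symmetric; it is compared with the gradient of `W`
    -- only after pairing with the symmetric `∂K/∂η_i`.
    · rw [matrixDeriv_limitRisk β hSig (hK η₀ hη₀), ← trace_limit_gradient β _ Sig (hK η₀ hη₀)
        (partialDeriv_transpose hK hKdiff i hη₀)]
      have hKi : Tendsto (partialDeriv K i) (𝓝 η₀) (𝓝 (partialDeriv K i η₀)) :=
        (hKcont i).continuousAt (isOpen_interior.mem_nhds hη₀)
      have t := tendsto_finsetSum Finset.univ fun a _ => tendsto_finsetSum Finset.univ fun b _ =>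
        (hgrad η₀ hη₀ a b).mul
          ((tendsto_pi_nhds.1 (tendsto_pi_nhds.1 hKi b) a).comp tendsto_snd)
      rw [← mul_div_assoc]
      simp only [Matrix.trace, Matrix.diag_apply, Matrix.mul_apply (N := partialDeriv K i _),
        Finset.mul_sum]
      refine t.congr fun x => ?_
      simp only [Function.comp_apply, mul_assoc]
  -- Local uniformity in the parameter specializes to the fixed parameter `η`.
  · have hx : Tendsto (fun x : ℕ × Ω => (x, η)) (probFilter P) (probFilter P ×ˢ 𝓝 η) :=
      tendsto_id.prodMk tendsto_const_nhds
    have h := (hgrad η hη a b).comp hx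
    simp only [Function.comp_def] at h
    exact h

end LKOCV

theorem theorem3
    {Ω : Type*} [MeasurableSpace Ω] (P : Measure Ω) [IsProbabilityMeasure P]
    {p m : ℕ} (β : Fin p → ℝ) (σ : ℝ) (hσ : 0 < σ)
    -- the design matrices and the i.i.d. noise
    (X : (n : ℕ) → Matrix (Fin n) (Fin p) ℝ) (ε : ℕ → Ω → ℝ)
    (hindep : iIndepFun ε P) (hident : ∀ i, IdentDistrib (ε i) (ε 0) P P)
    (hmean : ∀ i, ∫ ω, ε i ω ∂P = 0) (hvar : ∀ i, variance (ε i) P = σ ^ 2)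
    -- convergence of the design, positive definiteness of the kernel matrix
    (Sig : Matrix (Fin p) (Fin p) ℝ) (hSig : Sig.PosDef)
    (hX : Tendsto (fun n : ℕ => (n : ℝ)⁻¹ • ((X n)ᵀ * X n)) atTop (𝓝 Sig))
    (Θ : Set (EuclideanSpace ℝ (Fin m)))
    (K : EuclideanSpace ℝ (Fin m) → Matrix (Fin p) (Fin p) ℝ)
    (hK : ∀ η ∈ interior Θ, (K η).PosDef)
    -- the global minima of the limiting risk exist, are interior and are isolated
    (hmin : (LKOCV.minimizers (LKOCV.limitRisk β Sig) K Θ).Nonempty)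
    (hmin_int : LKOCV.minimizers (LKOCV.limitRisk β Sig) K Θ ⊆ interior Θ)
    (hmin_iso : ∀ η ∈ LKOCV.minimizers (LKOCV.limitRisk β Sig) K Θ,
      ∃ r > 0, ∀ η' ∈ LKOCV.minimizers (LKOCV.limitRisk β Sig) K Θ, dist η' η < r → η' = η)
    -- fourth moments, bounded covariates, continuous partial derivatives of the kernel matrix
    (hmom : ∃ c₃ : ℝ, ∀ i, Integrable (fun ω => |ε i ω| ^ 4) P ∧ ∫ ω, |ε i ω| ^ 4 ∂P ≤ c₃)
    (hbdd : ∃ c₄ : ℝ, ∀ (n : ℕ) (i : Fin n), ‖WithLp.toLp 2 (X n i)‖ ≤ c₄)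
    (hKdiff : ∀ (i : Fin m) (a b : Fin p), ∀ η ∈ interior Θ,
      LineDifferentiableAt ℝ (fun η' => K η' a b) η (EuclideanSpace.single i 1))
    (hKcont : ∀ i : Fin m, ContinuousOn (LKOCV.partialDeriv K i) (interior Θ))
    -- the block sizes
    (k : ℕ → ℕ) (hk : ∀ᶠ n in atTop, 1 ≤ k n ∧ k n < n)
    (lam : ℝ) (hlam : Tendsto (fun n : ℕ => (k n : ℝ) / n) atTop (𝓝 lam)) :
    (lam = 0 →
      LKOCV.IsAOFirstOrder P (fun n ω => LKOCV.lkocv σ (k n) (X n) (LKOCV.obs β (X n) ε ω))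
        (LKOCV.limitRisk β Sig) K Θ ∧
      ∀ η ∈ interior Θ, ∀ a b : Fin p,
        TendstoInMeasure P
          (fun (n : ℕ) ω => (n : ℝ) ^ 2 * LKOCV.matrixDeriv
            (LKOCV.lkocv σ (k n) (X n) (LKOCV.obs β (X n) ε ω)) (K η) a b)
          atTop
          (fun _ => ((2 * σ ^ 4) •
            ((K η)⁻¹ * Sig⁻¹ * (K η)⁻¹ * (K η - vecMulVec β β) * (K η)⁻¹)) a b)) ∧
    (0 < lam → lam < 1 → LKOCV.BlocksConverge X k Sig →
      LKOCV.IsAOFirstOrder P (fun n ω => LKOCV.lkocv σ (k n) (X n) (LKOCV.obs β (X n) ε ω))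
        (LKOCV.limitRisk β Sig) K Θ ∧
      ∀ η ∈ interior Θ, ∀ a b : Fin p,
        TendstoInMeasure P
          (fun (n : ℕ) ω => (n : ℝ) ^ 2 * LKOCV.matrixDeriv
            (LKOCV.lkocv σ (k n) (X n) (LKOCV.obs β (X n) ε ω)) (K η) a b)
          atTop
          (fun _ => ((2 * σ ^ 4 / (1 - lam) ^ 2) •
            ((K η)⁻¹ * Sig⁻¹ * (K η)⁻¹ * (K η - vecMulVec β β) * (K η)⁻¹)) a b)) := by
  obtain ⟨c₃, hc₃⟩ := hmom
  obtain ⟨c₄, hc₄⟩ := hbdd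
  have hbdd' : ∀ n i a, |X n i a| ≤ |c₄| := fun n i a =>
    (PiLp.norm_apply_le (WithLp.toLp 2 (X n i)) a).trans ((hc₄ n i).trans (le_abs_self _))
  refine ⟨fun h0 => ?_, fun _ h1 hB => ?_⟩
  · subst h0
    -- When `lam = 0` the blocks are a vanishing fraction of bounded rows, so their scaled Gram
    -- matrices tend to `0` uniformly without further assumption.
    have h := LKOCV.isAOFirstOrder_and_tendsto_matrixDeriv β hσ hindep hident hmean hvar hSig hX hK
      hmin hmin_int hmin_iso (fun i => (hc₃ i).1) (abs_nonneg c₄) hbdd' hKdiff hKcont hk hlam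
      one_pos (LKOCV.tendsto_rows_gram_of_zero (abs_nonneg c₄) hbdd' hlam)
    simpa only [sub_zero, one_pow, div_one] using h
  · exact LKOCV.isAOFirstOrder_and_tendsto_matrixDeriv β hσ hindep hident hmean hvar hSig hX hK
      hmin hmin_int hmin_iso (fun i => (hc₃ i).1) (abs_nonneg c₄) hbdd' hKdiff hKcont hk hlam
      h1 (LKOCV.tendsto_rows_gram_of_blocksConverge hk hlam hB)
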